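/- **Setting.** Fix $\alpha\in(0,2)$. Let $\Omega:\mathbb{R}\to(0,\infty)$ be a $C^\infty$ function and put $A=\Omega''+2\Omega'$. Assume that $\Omega$ belongs to the following class $\mathcal{C}$: * $\Omega'(t)<0$ and $\int_{-\infty}^t e^{2\tau}A(\tau)\,d\tau<0$ for all $t\in\mathbb{R}$; * there are $0<M_1<M$ and $c_0>0$ such that $\Omega(t)=\Omega(-\infty)-c_0e^{2t}$ for all $t\le\log M_1$, where $\Omega(-\infty)=\lim_{t\to-\infty}\Omega(t)$, and $\Omega'(t)+2\Omega(t)=e^{-\alpha t}$ for all $t\ge\log M$; * $A$ has exactly two zeroes $a<b$, and $A'(a)>0$, $A'(b)<0$. For real $m>0$ let $\mathbf{U}_m$ be the set of all $\mu\in\mathbb{C}$ with $\operatorname{Im}\mu>0$ for which the equation $$-\psi''+m^2\psi+\frac{A(t)}{\Omega(t)-\mu}\,\psi=0,\qquad t\in\mathbb{R},$$ has a solution $\psi\in L^2(\mathbb{R})$, $\psi\not\equiv0$ (complex valued). **Proposition 3.3.** Let $m_0\in[1,\infty)$ and $\mu_0\in(0,\Omega(-\infty))$ be such that $(m_0,\mu_0)$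 is a limit point of the set $$\{(m,\mu)\in(0,\infty)\times\mathbb{C}\;:\;\mu\in\mathbf{U}_m\}.$$ Then $\mu_0=\Omega(a)$ or $\mu_0=\Omega(b)$. Moreover, the limiting equation $$-\psi_0''+m_0^2\psi_0+\frac{A(t)}{\Omega(t)-\mu_0}\,\psi_0=0,\qquad t\in\mathbb{R},$$ where the quotient is extended continuously through its removable singularity at the point at which $\Omega=\mu_0$, has a solution $\psi_0\in L^2(\mathbb{R})\cap C^2(\mathbb{R})$, $\psi_0\not\equiv0$, which decays exponentially at $\pm\infty$: there are $C$ and $\delta>0$ with $|\psi_0(t)|\le Ce^{-\delta|t|}$ for all $t\in\mathbb{R}$. -/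

import Mathlib

open MeasureTheory Filter Topology
open scoped ContDiff

namespace RadialFlow

/-- The vorticity in the logarithmic variable `t = log s`, i.e. `G (e ^ t) = Ω' + 2 Ω`,
where `Ω t` is the angular velocity at radius `e ^ t`. -/
noncomputable def vorticity (Ω : ℝ → ℝ) (t : ℝ) : ℝ :=
  deriv Ω t + 2 * Ω t

/-- The coefficient `A = Ω'' + 2 Ω'`, the `t`-derivative of the vorticity. -/
noncomputable def coeffA (Ω : ℝ → ℝ) (t : ℝ) : ℝ :=
  deriv (deriv Ω) t + 2 * deriv Ω t

/-- `IsClassC α Ω Ωinf a b`: the angular velocity profile `Ω` belongs to the class `𝒞` with decay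
exponent `α`, `Ωinf` is its limit at `-∞`, and `a < b` are the two zeroes of `A = Ω'' + 2 Ω'`. -/
structure IsClassC (α : ℝ) (Ω : ℝ → ℝ) (Ωinf a b : ℝ) : Prop where
  smooth : ContDiff ℝ ∞ Ω
  pos : ∀ t, 0 < Ω t
  deriv_neg : ∀ t, deriv Ω t < 0
  integral_neg : ∀ t, ∫ τ in Set.Iic t, Real.exp (2 * τ) * coeffA Ω τ < 0
  tendsto_atBot : Tendsto Ω atBot (𝓝 Ωinf)
  /-- Near the origin (`s ≤ M₁`) `Ω = Ω(-∞) - c₀ s²`, and the vorticity is exactly `s ^ (-α)`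
  for `s ≥ M`, where `s = e ^ t`. -/
  ends : ∃ M M₁ c₀ : ℝ, 0 < M₁ ∧ M₁ < M ∧ 0 < c₀ ∧
    (∀ t ≤ Real.log M₁, Ω t = Ωinf - c₀ * Real.exp (2 * t)) ∧
    (∀ t ≥ Real.log M, vorticity Ω t = Real.exp (-α * t))
  a_lt_b : a < b
  zeroes : ∀ t, coeffA Ω t = 0 ↔ t = a ∨ t = b
  deriv_a : 0 < deriv (coeffA Ω) a
  deriv_b : deriv (coeffA Ω) b < 0

/-- `ψ ∈ L²(ℝ)` is a (twice continuously differentiable) solution on `ℝ` of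
`-ψ'' + m² ψ + (Ω - μ)⁻¹ A ψ = 0`.

If `μ` is not real, the condition `Ω t ≠ μ` holds for every `t`. If `μ = Ω d` where `d` is a zero
of `A`, only the point `t = d` is left out, where the quotient `A / (Ω - μ)` is `0 / 0` and has a
removable singularity; as `ψ''` is continuous there as well, the equation holds at `d` too, with the
value of the quotient at `d` being its limit. -/
structure IsL2Solution (Ω : ℝ → ℝ) (m : ℝ) (μ : ℂ) (ψ : ℝ → ℂ) : Prop where
  contDiff : ContDiff ℝ 2 ψ
  memLp : MemLp ψ 2 volume
  eqn : ∀ t : ℝ, (Ω t : ℂ) ≠ μ →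
    -(deriv (deriv ψ) t) + (m : ℂ) ^ 2 * ψ t + ((Ω t : ℂ) - μ)⁻¹ * (coeffA Ω t : ℂ) * ψ t = 0

/-- The set of unstable eigenvalues for the (real) wave number `m`. -/
def unstableSet (Ω : ℝ → ℝ) (m : ℝ) : Set ℂ :=
  {μ | 0 < μ.im ∧ ∃ ψ : ℝ → ℂ, ψ ≠ 0 ∧ IsL2Solution Ω m μ ψ}

/-- The set of unstable pairs `{(m, μ) ∈ (0, ∞) × ℂ | μ ∈ unstableSet Ω m}`. -/
def unstablePairs (Ω : ℝ → ℝ) : Set (ℝ × ℂ) :=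
  {p | 0 < p.1 ∧ p.2 ∈ unstableSet Ω p.1}

end RadialFlow

/-! Let `d` be the point with `Ω d = μ₀`; it exists because Ω decreases from Ω(-∞) to 0. The
potential A/(Ω - μ) may become singular at `d` as μ → μ₀. It equals (A/Ω') (log(μ - Ω))', so once
(A/Ω') log(μ - Ω) ψ is subtracted from ψ', the resulting first order system contains only log and
log², which are integrable uniformly in μ. Modes normalised at `d` are therefore bounded and Hölder
continuous of exponent 1/2 on compact intervals, uniformly in (m, μ)
(`IsClassC.exists_state_bound`). Outside a compact set they decay exponentially at a uniform rate
(`IsL2Solution.norm_sq_le_mul_exp`). This yields a limiting mode with non-zero state at `d`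
(`IsClassC.exists_isLimitMode`).

Two arguments identify `d`. Flux (`IsLimitMode.slopeRatio_mul_eq_zero`): off `d` the derivative of
ψ̄ψ' is real, and ψ̄ψ' → 0 at ±∞, so Im ψ̄ψ' vanishes on both sides of `d`. The logarithm inherited
from Im μ > 0 has imaginary part π on the left of `d` and 0 on the right. Comparing the one-sided
limits gives (A/Ω')|ψ|² = 0 at `d`.

Comparison (`IsLimitMode.ne_zero_at`): suppose ψ(d) = 0. The function e^t(Ω - μ₀) solves the
equation with wave number 1 and also vanishes at `d`. Since m₀ ≥ 1, a Picone type identity on (d, ∞)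
forces ψ to be a multiple of it. As it is unbounded at +∞ while ψ decays, ψ vanishes on (d, ∞), and
then so does the state at `d`, against the normalisation.

Hence A(d) = 0, so `d` is `a` or `b`, the quotient A/(Ω - μ₀) extends continuously, and the limiting
mode is a C² solution. -/

namespace RadialFlow

/-! ### Growth estimates for vector valued functions -/

section Growth

variable {E : Type*} [NormedAddCommGroup E] [NormedSpace ℝ E]

/-- Grönwall's inequality with the rate given through a primitive: near the singular point `K'` is
huge, but the increments of `K` stay bounded. -/
theorem norm_le_mul_exp_of_norm_deriv_le {X X' : ℝ → E} {K K' : ℝ → ℝ} {s t : ℝ} (hst : s ≤ t)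
    (hX : ∀ r, HasDerivAt X (X' r) r) (hK : ∀ r, HasDerivAt K (K' r) r)
    (h : ∀ r ∈ Set.Icc s t, ‖X' r‖ ≤ K' r * ‖X r‖) :
    ‖X t‖ ≤ ‖X s‖ * Real.exp (K t - K s) := by
  -- The slack ε, in the initial value and in the exponent, makes the differential inequality strict
  -- at a contact point; it is sent to 0 afterwards.
  have key : ∀ ε > 0, ‖X t‖ ≤ (‖X s‖ + ε) * Real.exp (K t - K s + ε * (t - s)) := by
    intro ε hε
    have hB : ∀ r, HasDerivAt (fun r => (‖X s‖ + ε) * Real.exp (K r - K s + ε * (r - s)))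
        ((‖X s‖ + ε) * (Real.exp (K r - K s + ε * (r - s)) * (K' r + ε))) r := by
      intro r
      have h1 : HasDerivAt (fun r => K r - K s + ε * (r - s)) (K' r + ε) r := by
        exact (((hK r).sub_const (K s)).add
          (((hasDerivAt_id r).sub_const s).const_mul ε)).congr_deriv (by simp)
      exact h1.exp.const_mul _
    refine image_norm_le_of_norm_deriv_right_lt_deriv_boundary
      (fun r _ => (hX r).continuousAt.continuousWithinAt) (fun r _ => (hX r).hasDerivWithinAt)
      ?_ hB ?_ (Set.right_mem_Icc.2 hst)
    · simp [hε.le]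
    · intro r hr hr'
      have h1 := h r ⟨hr.1, hr.2.le⟩
      have h2 : 0 < (‖X s‖ + ε) * Real.exp (K r - K s + ε * (r - s)) := by positivity
      rw [hr'] at h1
      nlinarith
  have hlim : Tendsto (fun ε : ℝ => (‖X s‖ + ε) * Real.exp (K t - K s + ε * (t - s))) (𝓝[>] 0)
      (𝓝 ((‖X s‖ + 0) * Real.exp (K t - K s + 0 * (t - s)))) := by
    refine Tendsto.mono_left ?_ nhdsWithin_le_nhds
    exact Continuous.tendsto (by fun_prop) 0
  have := ge_of_tendsto hlim (eventually_nhdsWithin_of_forall fun ε hε => key ε hε)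
  simpa using this

theorem norm_le_mul_exp_of_norm_deriv_le_left {X X' : ℝ → E} {K K' : ℝ → ℝ} {s t : ℝ}
    (hst : s ≤ t) (hX : ∀ r, HasDerivAt X (X' r) r) (hK : ∀ r, HasDerivAt K (K' r) r)
    (h : ∀ r ∈ Set.Icc s t, ‖X' r‖ ≤ K' r * ‖X r‖) :
    ‖X s‖ ≤ ‖X t‖ * Real.exp (K t - K s) := by
  have hn : ∀ r : ℝ, HasDerivAt (fun r : ℝ => -r) (-1) r := fun r => (hasDerivAt_id r).neg
  have := norm_le_mul_exp_of_norm_deriv_le (X := fun r => X (-r)) (X' := fun r => -X' (-r))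
    (K := fun r => -K (-r)) (K' := fun r => K' (-r)) (neg_le_neg hst)
    (fun r => by simpa [Function.comp_def] using (hX (-r)).scomp r (hn r))
    (fun r => ((hK (-r)).comp r (hn r)).neg.congr_deriv (by simp))
    (fun r hr => by
      have := h (-r) ⟨by linarith [hr.2], by linarith [hr.1]⟩
      simpa using this)
  simpa [sub_eq_neg_add, add_comm] using this

theorem norm_sub_le_of_norm_deriv_le_deriv {X X' : ℝ → E} {K K' : ℝ → ℝ} {s t : ℝ} (hst : s ≤ t)
    (hX : ∀ r, HasDerivAt X (X' r) r) (hK : ∀ r, HasDerivAt K (K' r) r)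
    (h : ∀ r ∈ Set.Icc s t, ‖X' r‖ ≤ K' r) : ‖X t - X s‖ ≤ K t - K s := by
  refine image_norm_le_of_norm_deriv_right_le_deriv_boundary (f := fun r => X r - X s)
    (B := fun r => K r - K s) (f' := X') (B' := K')
      (fun r _ => ((hX r).sub_const _).continuousAt.continuousWithinAt)
      (fun r _ => ((hX r).sub_const _).hasDerivWithinAt)
      (by simp) (fun r => (hK r).sub_const _) (fun r hr => h r ⟨hr.1, hr.2.le⟩)
      (Set.right_mem_Icc.2 hst)

/-- The mean value inequality applied twice: to `G`, then to `F x - (x - t) • G t` on the segment.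
-/
theorem norm_taylor_one_le {F G H : ℝ → E} {t r C : ℝ}
    (hF : ∀ s ∈ Metric.ball t r, HasDerivAt F (G s) s)
    (hG : ∀ s ∈ Metric.ball t r, HasDerivAt G (H s) s)
    (hH : ∀ s ∈ Metric.ball t r, ‖H s‖ ≤ C) {s : ℝ} (hs : s ∈ Metric.ball t r) :
    ‖F s - F t - (s - t) • G t‖ ≤ C * |s - t| * |s - t| := by
  have hr : 0 < r := Metric.pos_of_mem_ball hs
  have hsub : Set.uIcc t s ⊆ Metric.ball t r := by
    rw [← segment_eq_uIcc]
    exact (convex_ball t r).segment_subset (Metric.mem_ball_self hr) hs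
  have hC : 0 ≤ C := (norm_nonneg _).trans (hH s hs)
  have h1 : ∀ x ∈ Set.uIcc t s, ‖G x - G t‖ ≤ C * |s - t| := by
    intro x hx
    have := (convex_ball t r).norm_image_sub_le_of_norm_hasDerivWithin_le
      (fun y hy => (hG y hy).hasDerivWithinAt) hH (Metric.mem_ball_self hr) (hsub hx)
    refine this.trans (mul_le_mul_of_nonneg_left ?_ hC)
    rw [Real.norm_eq_abs]
    exact Set.abs_sub_left_of_mem_uIcc hx
  have h2 := (convex_uIcc t s).norm_image_sub_le_of_norm_hasDerivWithin_le
    (f := fun x => F x - (x - t) • G t) (f' := fun x => G x - G t) (C := C * |s - t|)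
    (fun x hx => by
      have h3 : HasDerivAt (fun x : ℝ => (x - t) • G t) (G t) x := by
        simpa using ((hasDerivAt_id x).sub_const t).smul_const (G t)
      exact ((hF x (hsub hx)).sub h3).hasDerivWithinAt) h1 Set.left_mem_uIcc Set.right_mem_uIcc
  simpa [sub_right_comm] using h2

/-- A quadratic remainder bound is closed under pointwise limits, so the limit is differentiable
without uniform convergence of the derivatives. -/
theorem hasDerivAt_of_tendsto_of_taylor {ι : Type*} {l : Filter ι} [l.NeBot] {F G : ι → ℝ → E}
    {F₀ : ℝ → E} {g : E} {t r C : ℝ} (hr : 0 < r)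
    (hF : ∀ s ∈ Metric.ball t r, Tendsto (fun i => F i s) l (𝓝 (F₀ s)))
    (hG : Tendsto (fun i => G i t) l (𝓝 g))
    (h : ∀ᶠ i in l, ∀ s ∈ Metric.ball t r,
      ‖F i s - F i t - (s - t) • G i t‖ ≤ C * |s - t| * |s - t|) :
    HasDerivAt F₀ g t := by
  have hb : ∀ s ∈ Metric.ball t r, ‖F₀ s - F₀ t - (s - t) • g‖ ≤ C * |s - t| * |s - t| := by
    intro s hs
    refine le_of_tendsto (((hF s hs).sub (hF t (Metric.mem_ball_self hr))).sub
      (hG.const_smul (s - t))).norm ?_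
    filter_upwards [h] with i hi using hi s hs
  rw [hasDerivAt_iff_isLittleO]
  refine Asymptotics.IsBigO.trans_isLittleO (g := fun s => C * |s - t| * |s - t|) ?_ ?_
  · refine Asymptotics.IsBigO.of_bound 1 ?_
    filter_upwards [Metric.ball_mem_nhds t hr] with s hs
    rw [one_mul]
    exact (hb s hs).trans (le_abs_self _)
  · rw [Asymptotics.isLittleO_iff_tendsto']
    · have h1 : Tendsto (fun s => C * |s - t| * (|s - t| / (s - t))) (𝓝 t) (𝓝 0) := by
        have h0 : Tendsto (fun s => C * |s - t|) (𝓝 t) (𝓝 0) := by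
          have : Continuous (fun s => C * |s - t|) := by fun_prop
          simpa using this.tendsto t
        refine h0.zero_mul_isBoundedUnder_le ?_
        refine isBoundedUnder_of ⟨1, fun s => ?_⟩
        simp only [Function.comp, norm_div, Real.norm_eq_abs, abs_abs]
        exact div_self_le_one _
      simpa [mul_div_assoc] using h1
    · exact Eventually.of_forall fun s hs => by simp [hs]

end Growth

/-! ### The square root on the upper half-plane -/

/-- The principal square root. -/
noncomputable def csqrt (z : ℂ) : ℂ := Complex.exp (Complex.log z / 2)

theorem csqrt_sq {z : ℂ} (hz : z ≠ 0) : csqrt z * csqrt z = z := by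
  rw [csqrt, ← Complex.exp_add, add_halves, Complex.exp_log hz]

theorem csqrt_ne_zero (z : ℂ) : csqrt z ≠ 0 := Complex.exp_ne_zero _

theorem norm_csqrt_sq {z : ℂ} (hz : z ≠ 0) : ‖csqrt z‖ * ‖csqrt z‖ = ‖z‖ := by
  rw [← norm_mul, csqrt_sq hz]

theorem norm_csqrt {z : ℂ} (hz : z ≠ 0) : ‖csqrt z‖ = √‖z‖ := by
  rw [← norm_csqrt_sq hz, Real.sqrt_mul_self (norm_nonneg _)]

/-- The argument lies strictly between 0 and π, so half of it lies in the first quadrant. -/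
theorem csqrt_re_im_pos {z : ℂ} (hz : 0 < z.im) : 0 < (csqrt z).re ∧ 0 < (csqrt z).im := by
  have h0 : 0 < z.arg := by
    refine lt_of_le_of_ne (Complex.arg_nonneg_iff.2 hz.le) fun h => ?_
    exact hz.ne' (Complex.arg_eq_zero_iff.1 h.symm).2
  have h1 : z.arg < Real.pi :=
    lt_of_le_of_ne (Complex.arg_le_pi z) fun h => hz.ne' (Complex.arg_eq_pi_iff.1 h).2
  have him : (Complex.log z / 2).im = z.arg / 2 := by
    simp [Complex.log_im]
  rw [csqrt, Complex.exp_re, Complex.exp_im, him]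
  refine ⟨mul_pos (Real.exp_pos _) (Real.cos_pos_of_mem_Ioo ⟨?_, ?_⟩),
    mul_pos (Real.exp_pos _) (Real.sin_pos_of_pos_of_lt_pi ?_ ?_)⟩ <;> linarith

/-- A real valued function on the upper half-plane which is Hölder continuous of exponent `1/2`, and
whose derivative along horizontal lines dominates `‖z‖ ^ (-1/2)`. -/
noncomputable def sqrtPotential (z : ℂ) : ℝ := (csqrt z).re - (csqrt z).im

/-- Both roots x, y lie in the first quadrant, so |x - y| ≤ |x + y| and |x - y|² ≤ |x² - y²| = |z -
w|. -/
theorem abs_sqrtPotential_sub_le {z w : ℂ} (hz : 0 < z.im) (hw : 0 < w.im) :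
    |sqrtPotential z - sqrtPotential w| ≤ 2 * √‖z - w‖ := by
  have hz0 : z ≠ 0 := fun h => by simp [h] at hz
  have hw0 : w ≠ 0 := fun h => by simp [h] at hw
  set x := csqrt z with hx
  set y := csqrt w with hy
  obtain ⟨h1, h2⟩ := csqrt_re_im_pos hz
  obtain ⟨h3, h4⟩ := csqrt_re_im_pos hw
  have h5 : ‖x - y‖ ≤ ‖x + y‖ := by
    rw [Complex.norm_def, Complex.norm_def]
    apply Real.sqrt_le_sqrt
    simp only [Complex.normSq_apply, Complex.sub_re, Complex.sub_im, Complex.add_re, Complex.add_im]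
    nlinarith [mul_pos h1 h3, mul_pos h2 h4]
  have h6 : ‖x - y‖ ≤ √‖z - w‖ := by
    apply Real.le_sqrt_of_sq_le
    have : z - w = (x - y) * (x + y) := by
      rw [← csqrt_sq hz0, ← csqrt_sq hw0]; ring
    rw [this, norm_mul, sq]
    exact mul_le_mul_of_nonneg_left h5 (norm_nonneg _)
  have h7 : sqrtPotential z - sqrtPotential w = (x - y).re - (x - y).im := by
    simp only [sqrtPotential, Complex.sub_re, Complex.sub_im]; ring
  rw [h7]
  calc |(x - y).re - (x - y).im| ≤ |(x - y).re| + |(x - y).im| := abs_sub _ _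
    _ ≤ ‖x - y‖ + ‖x - y‖ := add_le_add (Complex.abs_re_le_norm _) (Complex.abs_im_le_norm _)
    _ ≤ _ := by linarith

/-- With x = √z, the factor is Re(1/2x) - Im(1/2x) = (Re x + Im x)/(2|x|²), and Re x + Im x ≥ |x| in
the first quadrant. The minus sign in the potential makes both contributions positive. -/
theorem hasDerivAt_sqrtPotential {z : ℝ → ℂ} {z' t : ℝ} (hz : HasDerivAt z (z' : ℂ) t)
    (him : 0 < (z t).im) :
    ∃ p : ℝ, HasDerivAt (fun s => sqrtPotential (z s)) (z' * p) t ∧ 1 / (2 * √‖z t‖) ≤ p := by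
  have hz0 : z t ≠ 0 := fun h => by simp [h] at him
  set x := csqrt (z t) with hx
  have hx0 : x ≠ 0 := csqrt_ne_zero _
  have h1 : HasDerivAt (fun s => csqrt (z s)) ((z' : ℂ) * (1 / (2 * x))) t := by
    have := ((hz.clog_real (Or.inr him.ne')).div_const 2).cexp
    refine this.congr_deriv ?_
    change x * _ = _
    rw [← csqrt_sq hz0, ← hx]
    field_simp
  have hre : HasDerivAt (fun s => (csqrt (z s)).re) ((z' : ℂ) * (1 / (2 * x))).re t := by
    simpa [Function.comp_def] using (Complex.reCLM.hasFDerivAt.comp_hasDerivAt t h1)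
  have hi : HasDerivAt (fun s => (csqrt (z s)).im) ((z' : ℂ) * (1 / (2 * x))).im t := by
    simpa [Function.comp_def] using (Complex.imCLM.hasFDerivAt.comp_hasDerivAt t h1)
  refine ⟨(1 / (2 * x)).re - (1 / (2 * x)).im, ?_, ?_⟩
  · refine (hre.sub hi).congr_deriv ?_
    rw [Complex.re_ofReal_mul, Complex.im_ofReal_mul]; ring
  · obtain ⟨h2, h3⟩ := csqrt_re_im_pos him
    rw [← hx] at h2 h3
    have h4 : ‖x‖ ≤ x.re + x.im := by
      have := Complex.norm_le_abs_re_add_abs_im x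
      rwa [abs_of_pos h2, abs_of_pos h3] at this
    have h5 : 0 < ‖x‖ := norm_pos_iff.2 hx0
    have h6 : (1 / (2 * x)).re - (1 / (2 * x)).im = (x.re + x.im) / (2 * ‖x‖ ^ 2) := by
      rw [Complex.sq_norm]
      have h7 : Complex.normSq x ≠ 0 := by simpa using hx0
      simp only [one_div, Complex.inv_re, Complex.inv_im, map_mul, Complex.mul_re, Complex.mul_im]
      simp
      field_simp
      ring
    rw [h6, ← norm_csqrt hz0, ← hx, div_le_div_iff₀ (by positivity) (by positivity)]
    nlinarith

/-- For ‖z‖ ≤ 1 write √‖z‖ = y²: each fourth root y absorbs one factor of the logarithm. For ‖z‖ ≥ 1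
everything is bounded in terms of `R`. -/
theorem exists_norm_log_sq_mul_sqrt_le (R : ℝ) :
    ∃ C > 0, ∀ z : ℂ, z ≠ 0 → ‖z‖ ≤ R → (1 + ‖Complex.log z‖ ^ 2) * √‖z‖ ≤ C := by
  refine ⟨(1 + (4 + |R| + Real.pi) ^ 2) * (1 + |R|), by positivity, fun z hz hR => ?_⟩
  have hz0 : 0 < ‖z‖ := norm_pos_iff.2 hz
  set y := √(√‖z‖) with hy
  have hy0 : 0 < y := by positivity
  have hy2 : y ^ 2 = √‖z‖ := Real.sq_sqrt (Real.sqrt_nonneg _)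
  have hsq : √‖z‖ ≤ 1 + |R| := by
    rw [Real.sqrt_le_left (by positivity)]
    nlinarith [le_abs_self R, abs_nonneg R]
  have h1 : ‖Complex.log z‖ ≤ |Real.log ‖z‖| + Real.pi := by
    have := Complex.norm_le_abs_re_add_abs_im (Complex.log z)
    rw [Complex.log_re, Complex.log_im] at this
    linarith [Complex.abs_arg_le_pi z]
  have hπ := Real.pi_pos
  have hR0 := abs_nonneg R
  rcases le_total ‖z‖ 1 with h | h
  · have hyl : y ≤ 1 := by
      rw [hy]; exact Real.sqrt_le_one.2 (Real.sqrt_le_one.2 h)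
    have h2 : |Real.log ‖z‖| * y ≤ 4 := by
      have := Real.abs_log_mul_self_rpow_lt ‖z‖ (1 / 4) hz0 h (by norm_num)
      have h4 : ‖z‖ ^ (1 / 4 : ℝ) = y := by
        rw [hy, Real.sqrt_eq_rpow, Real.sqrt_eq_rpow, ← Real.rpow_mul hz0.le]; norm_num
      rw [h4, abs_mul, abs_of_pos hy0] at this
      norm_num at this
      exact this.le
    have h3 : ‖Complex.log z‖ * y ≤ 4 + |R| + Real.pi := by nlinarith
    have h5 : (‖Complex.log z‖ * y) ^ 2 ≤ (4 + |R| + Real.pi) ^ 2 :=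
      pow_le_pow_left₀ (by positivity) h3 2
    have h6 : y ^ 2 ≤ 1 := pow_le_one₀ hy0.le hyl
    rw [← hy2]
    nlinarith [sq_nonneg (4 + |R| + Real.pi)]
  · have h2 : |Real.log ‖z‖| ≤ |R| := by
      rw [abs_of_nonneg (Real.log_nonneg h)]
      linarith [Real.log_le_sub_one_of_pos hz0, le_abs_self R]
    have h3 : ‖Complex.log z‖ ^ 2 ≤ (4 + |R| + Real.pi) ^ 2 :=
      pow_le_pow_left₀ (by positivity) (by linarith) 2
    exact mul_le_mul (by linarith) hsq (by positivity) (by positivity)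

/-! ### Decay of integrable functions with `f ≤ f''` -/

/-- Since f'' ≥ f, the function (f' + f)e^{-t} increases. If it were positive somewhere, f would
grow like e^t and not be integrable. Hence f' + f ≤ 0, that is, f e^t decreases. -/
theorem le_mul_exp_of_integrableOn_Ici {f f' f'' : ℝ → ℝ} {T : ℝ}
    (hf : ∀ t, HasDerivAt f (f' t) t) (hf' : ∀ t ≥ T, HasDerivAt f' (f'' t) t)
    (h : ∀ t ≥ T, f t ≤ f'' t) (hint : Integrable f) {t : ℝ} (ht : T ≤ t) :
    f t ≤ f T * Real.exp (-(t - T)) := by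
  have hexp : ∀ t, HasDerivAt (fun t : ℝ => Real.exp t) (Real.exp t) t := Real.hasDerivAt_exp
  have hnexp : ∀ t, HasDerivAt (fun t : ℝ => Real.exp (-t)) (-Real.exp (-t)) t := fun t => by
    simpa using (hasDerivAt_id t).neg.exp
  have hmono : MonotoneOn (fun t => (f' t + f t) * Real.exp (-t)) (Set.Ici T) := by
    have hd : ∀ t ≥ T, HasDerivAt (fun t => (f' t + f t) * Real.exp (-t))
        ((f'' t + f' t) * Real.exp (-t) + (f' t + f t) * (-Real.exp (-t))) t := fun t ht =>
      ((hf' t ht).add (hf t)).mul (hnexp t)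
    refine monotoneOn_of_hasDerivWithinAt_nonneg (convex_Ici T)
      (fun t ht => (hd t ht).continuousAt.continuousWithinAt)
      (fun t ht => (hd t (interior_subset ht)).hasDerivWithinAt) (fun t ht => ?_)
    have := h t (interior_subset ht)
    nlinarith [Real.exp_pos (-t)]
  have hd2 : ∀ t, HasDerivAt (fun t => f t * Real.exp t) (f' t * Real.exp t + f t * Real.exp t) t :=
    fun t => (hf t).mul (hexp t)
  have hneg : ∀ t ≥ T, f' t + f t ≤ 0 := by
    intro t₁ ht₁
    by_contra! hpos
    set c := (f' t₁ + f t₁) * Real.exp (-t₁) with hc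
    have hc0 : 0 < c := by positivity
    -- From f' + f ≥ c e^t on the half-line, (f e^t)' ≥ c e^{2t}, which is the derivative of (c/2)
    -- e^{2t}.
    have hm2 : MonotoneOn (fun t => f t * Real.exp t - c / 2 * (Real.exp t * Real.exp t))
        (Set.Ici t₁) := by
      have hd : ∀ t, HasDerivAt (fun t => f t * Real.exp t - c / 2 * (Real.exp t * Real.exp t))
        (f' t * Real.exp t + f t * Real.exp t -
          c / 2 * (Real.exp t * Real.exp t + Real.exp t * Real.exp t)) t := fun t =>
        (hd2 t).sub (((hexp t).mul (hexp t)).const_mul _)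
      refine monotoneOn_of_hasDerivWithinAt_nonneg (convex_Ici t₁)
        (fun t ht => (hd t).continuousAt.continuousWithinAt)
        (fun t ht => (hd t).hasDerivWithinAt) (fun t ht => ?_)
      have ht' : t₁ ≤ t := interior_subset ht
      have h1 : c ≤ (f' t + f t) * Real.exp (-t) :=
        hmono ht₁ (le_trans ht₁ ht') ht'
      have h2 : c * Real.exp t ≤ f' t + f t := by
        have := mul_le_mul_of_nonneg_right h1 (Real.exp_pos t).le
        rwa [mul_assoc (f' t + f t), ← Real.exp_add, neg_add_cancel, Real.exp_zero, mul_one] at this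
      nlinarith [Real.exp_pos t]
    set D := f t₁ * Real.exp t₁ - c / 2 * (Real.exp t₁ * Real.exp t₁) with hD
    have hlow : ∀ t ≥ t₁, D * Real.exp (-t) + c / 2 * Real.exp t ≤ f t := by
      intro t ht
      have h1 : D ≤ f t * Real.exp t - c / 2 * (Real.exp t * Real.exp t) :=
        hm2 Set.self_mem_Ici ht ht
      have h2 := mul_le_mul_of_nonneg_right h1 (Real.exp_pos (-t)).le
      have h3 : Real.exp t * Real.exp (-t) = 1 := by rw [← Real.exp_add]; simp
      have h4 : (f t * Real.exp t - c / 2 * (Real.exp t * Real.exp t)) * Real.exp (-t)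
        = (f t - c / 2 * Real.exp t) * (Real.exp t * Real.exp (-t)) := by ring
      rw [h4, h3] at h2
      linarith
    have hlim : Tendsto (fun t => D * Real.exp (-t) + c / 2 * Real.exp t) atTop atTop := by
      refine Tendsto.add_atTop (C := D * 0) ?_ ?_
      · exact (Real.tendsto_exp_neg_atTop_nhds_zero).const_mul D
      · exact Real.tendsto_exp_atTop.const_mul_atTop (by positivity)
    obtain ⟨t₂, ht₂⟩ := eventually_atTop.1 ((hlim.eventually_ge_atTop 1).and
      (eventually_ge_atTop t₁))
    have h1 : ∀ t ≥ t₂, 1 ≤ f t := fun t ht => (ht₂ t ht).1.trans (hlow t (ht₂ t ht).2)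
    have h2 : IntegrableOn (fun _ : ℝ => (1 : ℝ)) (Set.Ici t₂) := by
      refine Integrable.mono' hint.integrableOn aestronglyMeasurable_const ?_
      filter_upwards [ae_restrict_mem measurableSet_Ici] with t ht
      simpa using h1 t ht
    simp [integrableOn_const_iff] at h2
  have hanti : AntitoneOn (fun t => f t * Real.exp t) (Set.Ici T) := by
    refine antitoneOn_of_hasDerivWithinAt_nonpos (convex_Ici T)
      (fun t ht => (hd2 t).continuousAt.continuousWithinAt)
      (fun t ht => (hd2 t).hasDerivWithinAt) (fun t ht => ?_)
    have := hneg t (interior_subset ht)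
    nlinarith [Real.exp_pos t]
  have h1 : f t * Real.exp t ≤ f T * Real.exp T := hanti Set.self_mem_Ici ht ht
  have h2 := mul_le_mul_of_nonneg_right h1 (Real.exp_pos (-t)).le
  rw [mul_assoc, ← Real.exp_add, add_neg_cancel, Real.exp_zero, mul_one, mul_assoc,
    ← Real.exp_add] at h2
  rwa [neg_sub, sub_eq_add_neg]

/-! ### The regularised first order system -/

/-- The quotient `A / Ω'`. -/
noncomputable def slopeRatio (Ω : ℝ → ℝ) (t : ℝ) : ℝ := coeffA Ω t / deriv Ω t

/-- The logarithm of `μ - Ω`, which turns `A / (Ω - μ)` into a derivative. -/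
noncomputable def logGap (Ω : ℝ → ℝ) (μ : ℂ) (t : ℝ) : ℂ := Complex.log (μ - Ω t)

/-- The function `ψ' - (A / Ω') log (μ - Ω) ψ`, less singular than `ψ'` where `Ω` is close to `μ`. -/
noncomputable def quasiDeriv (Ω : ℝ → ℝ) (μ : ℂ) (ψ : ℝ → ℂ) (t : ℝ) : ℂ :=
  deriv ψ t - slopeRatio Ω t * logGap Ω μ t * ψ t

/-- The state `(ψ, ψ' - (A / Ω') log (μ - Ω) ψ)`. -/
noncomputable def state (Ω : ℝ → ℝ) (μ : ℂ) (ψ : ℝ → ℂ) (t : ℝ) : ℂ × ℂ :=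
  (ψ t, quasiDeriv Ω μ ψ t)

/-- The derivative of the state along a solution. -/
noncomputable def stateDeriv (Ω : ℝ → ℝ) (m : ℝ) (μ : ℂ) (ψ : ℝ → ℂ) (t : ℝ) : ℂ × ℂ :=
  (quasiDeriv Ω μ ψ t + slopeRatio Ω t * logGap Ω μ t * ψ t,
    (m ^ 2 - deriv (slopeRatio Ω) t * logGap Ω μ t
      - slopeRatio Ω t ^ 2 * logGap Ω μ t ^ 2) * ψ t
      - slopeRatio Ω t * logGap Ω μ t * quasiDeriv Ω μ ψ t)

/-! ### Regularity of the profile and the differential system for the state -/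

section Regularity

variable {α : ℝ} {Ω : ℝ → ℝ} {Ωinf a b : ℝ}

theorem IsClassC.contDiff_deriv (hΩ : IsClassC α Ω Ωinf a b) : ContDiff ℝ ∞ (deriv Ω) :=
  (contDiff_infty_iff_deriv.1 hΩ.smooth).2

theorem IsClassC.contDiff_coeffA (hΩ : IsClassC α Ω Ωinf a b) : ContDiff ℝ ∞ (coeffA Ω) :=
  ((contDiff_infty_iff_deriv.1 hΩ.contDiff_deriv).2).add (contDiff_const.mul hΩ.contDiff_deriv)

theorem IsClassC.contDiff_slopeRatio (hΩ : IsClassC α Ω Ωinf a b) :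
    ContDiff ℝ ∞ (slopeRatio Ω) :=
  hΩ.contDiff_coeffA.div hΩ.contDiff_deriv fun t => (hΩ.deriv_neg t).ne

theorem IsClassC.hasDerivAt (hΩ : IsClassC α Ω Ωinf a b) (t : ℝ) : HasDerivAt Ω (deriv Ω t) t :=
  (hΩ.smooth.differentiable (by simp) t).hasDerivAt

theorem IsClassC.hasDerivAt_deriv (hΩ : IsClassC α Ω Ωinf a b) (t : ℝ) :
    HasDerivAt (deriv Ω) (deriv (deriv Ω) t) t :=
  (hΩ.contDiff_deriv.differentiable (by simp) t).hasDerivAt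

theorem IsClassC.hasDerivAt_coeffA (hΩ : IsClassC α Ω Ωinf a b) (t : ℝ) :
    HasDerivAt (coeffA Ω) (deriv (coeffA Ω) t) t :=
  (hΩ.contDiff_coeffA.differentiable (by simp) t).hasDerivAt

theorem IsClassC.hasDerivAt_slopeRatio (hΩ : IsClassC α Ω Ωinf a b) (t : ℝ) :
    HasDerivAt (slopeRatio Ω) (deriv (slopeRatio Ω) t) t :=
  (hΩ.contDiff_slopeRatio.differentiable (by simp) t).hasDerivAt

theorem IsClassC.strictAnti (hΩ : IsClassC α Ω Ωinf a b) : StrictAnti Ω :=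
  strictAnti_of_deriv_neg hΩ.deriv_neg

theorem IsL2Solution.hasDerivAt {m : ℝ} {μ : ℂ} {ψ : ℝ → ℂ} (h : IsL2Solution Ω m μ ψ) (t : ℝ) :
    HasDerivAt ψ (deriv ψ t) t :=
  (h.contDiff.differentiable (by norm_num) t).hasDerivAt

theorem IsL2Solution.hasDerivAt_deriv {m : ℝ} {μ : ℂ} {ψ : ℝ → ℂ} (h : IsL2Solution Ω m μ ψ)
    (hμ : 0 < μ.im) (t : ℝ) :
    HasDerivAt (deriv ψ) ((m ^ 2 + coeffA Ω t / (Ω t - μ)) * ψ t) t := by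
  have h2 : ContDiff ℝ (1 + 1) ψ := by simpa [one_add_one_eq_two] using h.contDiff
  have h1 := ((contDiff_succ_iff_deriv.1 h2).2.2.differentiable (by norm_num) t).hasDerivAt
  have hne : (Ω t : ℂ) ≠ μ := fun e => by simp [← e] at hμ
  have h3 := h.eqn t hne
  refine h1.congr_deriv ?_
  rw [div_eq_inv_mul]
  linear_combination -h3

theorem gap_im_pos {μ : ℂ} (hμ : 0 < μ.im) (Ω : ℝ → ℝ) (t : ℝ) : 0 < (μ - Ω t).im := by
  simpa using hμ

theorem gap_ne_zero {μ : ℂ} (hμ : 0 < μ.im) (Ω : ℝ → ℝ) (t : ℝ) : μ - Ω t ≠ 0 := fun h => by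
  have := gap_im_pos hμ Ω t
  simp [h] at this

theorem IsClassC.hasDerivAt_gap (hΩ : IsClassC α Ω Ωinf a b) (μ : ℂ) (t : ℝ) :
    HasDerivAt (fun t => μ - (Ω t : ℂ)) ((-deriv Ω t : ℝ) : ℂ) t := by
  refine ((hΩ.hasDerivAt t).ofReal_comp.const_sub μ).congr_deriv (by simp)

theorem IsClassC.hasDerivAt_logGap (hΩ : IsClassC α Ω Ωinf a b) {μ : ℂ} (hμ : 0 < μ.im) (t : ℝ) :
    HasDerivAt (logGap Ω μ) ((deriv Ω t : ℝ) / (Ω t - μ)) t := by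
  refine ((hΩ.hasDerivAt_gap μ t).clog_real (Or.inr (gap_im_pos hμ Ω t).ne')).congr_deriv ?_
  rw [← neg_sub μ, div_neg, Complex.ofReal_neg, neg_div]

/-- The singular term A/(Ω - μ) ψ of ψ'' cancels against the derivative of the logarithm in the
correction; only log and log² survive. -/
theorem IsClassC.hasDerivAt_state (hΩ : IsClassC α Ω Ωinf a b) {m : ℝ} {μ : ℂ} {ψ : ℝ → ℂ}
    (h : IsL2Solution Ω m μ ψ) (hμ : 0 < μ.im) (t : ℝ) :
    HasDerivAt (state Ω μ ψ) (stateDeriv Ω m μ ψ t) t := by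
  refine HasDerivAt.prodMk ?_ ?_
  · refine (h.hasDerivAt t).congr_deriv ?_
    simp [quasiDeriv]
  · have h1 := (h.hasDerivAt_deriv hμ t).sub
      (((hΩ.hasDerivAt_slopeRatio t).ofReal_comp.mul (hΩ.hasDerivAt_logGap hμ t)).mul
        (h.hasDerivAt t))
    refine h1.congr_deriv ?_
    have h2 : ((deriv Ω t : ℝ) : ℂ) ≠ 0 := by exact_mod_cast (hΩ.deriv_neg t).ne
    have h3 : (slopeRatio Ω t : ℂ) * ((deriv Ω t : ℝ) / (Ω t - μ)) = coeffA Ω t / (Ω t - μ) := by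
      rw [slopeRatio, Complex.ofReal_div]; field_simp
    simp only [Pi.mul_apply, quasiDeriv]
    linear_combination -ψ t * h3

end Regularity

theorem norm_stateDeriv_le {Ω : ℝ → ℝ} {m : ℝ} {μ : ℂ} {ψ : ℝ → ℂ} {t B R : ℝ}
    (hm : |m| ≤ R) (h1 : |slopeRatio Ω t| ≤ B) (h2 : |deriv (slopeRatio Ω) t| ≤ B) :
    ‖stateDeriv Ω m μ ψ t‖ ≤
      (1 + R ^ 2 + 2 * B + B ^ 2) * (1 + ‖logGap Ω μ t‖ ^ 2) * ‖state Ω μ ψ t‖ := by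
  set ℓ := ‖logGap Ω μ t‖ with hℓ
  set N := ‖state Ω μ ψ t‖ with hN
  have hℓ0 : 0 ≤ ℓ := norm_nonneg _
  have hN0 : 0 ≤ N := norm_nonneg _
  have hB : 0 ≤ B := (abs_nonneg _).trans h1
  have hψ : ‖ψ t‖ ≤ N := norm_fst_le (state Ω μ ψ t)
  have hv : ‖quasiDeriv Ω μ ψ t‖ ≤ N := norm_snd_le (state Ω μ ψ t)
  have hbl : ‖(slopeRatio Ω t : ℂ) * logGap Ω μ t‖ ≤ B * ℓ := by
    rw [norm_mul, Complex.norm_real]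
    exact mul_le_mul_of_nonneg_right h1 hℓ0
  have hm2 : ‖(m : ℂ) ^ 2‖ ≤ R ^ 2 := by
    rw [norm_pow, Complex.norm_real]
    exact pow_le_pow_left₀ (abs_nonneg _) hm 2
  have hℓ2 : ℓ ≤ 1 + ℓ ^ 2 := by nlinarith [sq_nonneg (ℓ - 1)]
  rw [stateDeriv, Prod.norm_def]
  refine max_le ?_ ?_
  · refine (norm_add_le _ _).trans ?_
    rw [norm_mul]
    have := mul_le_mul hbl hψ (norm_nonneg _) (by positivity)
    have h3 : B * ℓ ≤ B * (1 + ℓ ^ 2) := mul_le_mul_of_nonneg_left hℓ2 hB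
    calc ‖quasiDeriv Ω μ ψ t‖ + ‖(slopeRatio Ω t : ℂ) * logGap Ω μ t‖ * ‖ψ t‖
        ≤ (1 + B * ℓ) * N := by linarith
      _ ≤ (1 + R ^ 2 + 2 * B + B ^ 2) * (1 + ℓ ^ 2) * N := by
          refine mul_le_mul_of_nonneg_right ?_ hN0
          nlinarith [mul_nonneg (sq_nonneg R) (sq_nonneg ℓ), mul_nonneg (sq_nonneg B) (sq_nonneg ℓ),
            mul_nonneg hB (sq_nonneg ℓ), sq_nonneg R, sq_nonneg B, sq_nonneg ℓ]
  · have h4 : ‖(m : ℂ) ^ 2 - deriv (slopeRatio Ω) t * logGap Ω μ t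
        - slopeRatio Ω t ^ 2 * logGap Ω μ t ^ 2‖ ≤ R ^ 2 + B * ℓ + (B * ℓ) ^ 2 := by
      refine (norm_sub_le _ _).trans (add_le_add ((norm_sub_le _ _).trans (add_le_add hm2 ?_)) ?_)
      · rw [norm_mul, Complex.norm_real]
        exact mul_le_mul_of_nonneg_right h2 hℓ0
      · rw [← mul_pow, norm_pow]
        exact pow_le_pow_left₀ (norm_nonneg _) hbl 2
    refine (norm_sub_le _ _).trans ?_
    rw [norm_mul, norm_mul _ (quasiDeriv Ω μ ψ t)]
    have h5 := mul_le_mul h4 hψ (norm_nonneg _) (by positivity)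
    have h6 := mul_le_mul hbl hv (norm_nonneg _) (by positivity)
    refine (add_le_add h5 h6).trans ?_
    rw [← add_mul]
    refine mul_le_mul_of_nonneg_right ?_ hN0
    have h3 : B * ℓ ≤ B * (1 + ℓ ^ 2) := mul_le_mul_of_nonneg_left hℓ2 hB
    nlinarith [mul_nonneg (sq_nonneg R) (sq_nonneg ℓ), mul_nonneg (sq_nonneg B) (sq_nonneg ℓ),
            mul_nonneg hB (sq_nonneg ℓ), sq_nonneg R, sq_nonneg B, sq_nonneg ℓ]

/-! ### Bounds on the state over compact intervals, uniform in the spectral parameter -/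

section Bounds

variable {α : ℝ} {Ω : ℝ → ℝ} {Ωinf a b : ℝ}

theorem exists_abs_le_Icc {f : ℝ → ℝ} (hf : Continuous f) (S T : ℝ) :
    ∃ B, 0 ≤ B ∧ ∀ t ∈ Set.Icc S T, |f t| ≤ B := by
  obtain ⟨B, hB⟩ := isCompact_Icc.exists_bound_of_continuousOn (s := Set.Icc S T) hf.continuousOn
  exact ⟨|B|, abs_nonneg B, fun t ht => (hB t ht).trans (le_abs_self B)⟩

/-- On compact sets 1 + |log|² is at most a multiple of ‖μ - Ω‖^(-1/2). As -Ω' is bounded below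
there, this is dominated by the derivative of a multiple of `sqrtPotential (μ - Ω)`. That potential
is Hölder with a constant that does not deteriorate as Im μ → 0. -/
theorem IsClassC.exists_comparison (hΩ : IsClassC α Ω Ωinf a b) (S T R : ℝ) :
    ∃ C > 0, ∀ (m : ℝ) (μ : ℂ) (ψ : ℝ → ℂ), |m| ≤ R → ‖μ‖ ≤ R → 0 < μ.im →
      ∃ K K' : ℝ → ℝ, (∀ t, HasDerivAt K (K' t) t) ∧
        (∀ t ∈ Set.Icc S T, 0 ≤ K' t ∧ ‖stateDeriv Ω m μ ψ t‖ ≤ K' t * ‖state Ω μ ψ t‖) ∧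
        ∀ s ∈ Set.Icc S T, ∀ t ∈ Set.Icc S T, |K t - K s| ≤ C * √|t - s| := by
  obtain ⟨B₁, hB₁, h1⟩ := exists_abs_le_Icc hΩ.contDiff_slopeRatio.continuous S T
  obtain ⟨B₂, hB₂, h2⟩ := exists_abs_le_Icc
    ((contDiff_infty_iff_deriv.1 hΩ.contDiff_slopeRatio).2).continuous S T
  obtain ⟨B₃, hB₃, h3⟩ := exists_abs_le_Icc hΩ.smooth.continuous S T
  obtain ⟨B₄, hB₄, h4⟩ := exists_abs_le_Icc hΩ.contDiff_deriv.continuous S T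
  obtain ⟨B₅, hB₅, h5⟩ := exists_abs_le_Icc
    (hΩ.contDiff_deriv.continuous.inv₀ fun t => (hΩ.deriv_neg t).ne) S T
  obtain ⟨Cl, hCl, hl⟩ := exists_norm_log_sq_mul_sqrt_le (R + B₃)
  set B := B₁ + B₂ with hB
  set D := (1 + R ^ 2 + 2 * B + B ^ 2) * Cl with hD
  have hB0 : 0 ≤ B := by positivity
  have hD0 : 0 < D := by positivity
  refine ⟨2 * D * (B₅ + 1) * (2 * √(B₄ + 1)), by positivity, fun m μ ψ hm hμR hμ => ?_⟩
  choose p hp hp' using fun t =>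
    hasDerivAt_sqrtPotential (hΩ.hasDerivAt_gap μ t) (gap_im_pos hμ Ω t)
  refine ⟨fun t => 2 * D * (B₅ + 1) * sqrtPotential (μ - Ω t),
    fun t => 2 * D * (B₅ + 1) * (-deriv Ω t * p t), fun t => (hp t).const_mul _, ?_, ?_⟩
  · intro t ht
    have hz0 : 0 < ‖μ - Ω t‖ := norm_pos_iff.2 (gap_ne_zero hμ Ω t)
    have hs0 : 0 < √‖μ - Ω t‖ := Real.sqrt_pos.2 hz0
    have hp0 : 0 < p t := lt_of_lt_of_le (by positivity) (hp' t)
    have hdn := hΩ.deriv_neg t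
    have hd : 1 ≤ (B₅ + 1) * -deriv Ω t := by
      have h6 := h5 t ht
      rw [Pi.inv_apply, abs_inv, abs_of_neg hdn] at h6
      have h7 : 0 < -deriv Ω t := by linarith
      have h8 := mul_le_mul_of_nonneg_right h6 h7.le
      rw [inv_mul_cancel₀ h7.ne'] at h8
      linarith
    have hz : ‖μ - Ω t‖ ≤ R + B₃ := by
      refine (norm_sub_le _ _).trans (add_le_add hμR ?_)
      rw [Complex.norm_real]
      exact h3 t ht
    have hlog : 1 + ‖logGap Ω μ t‖ ^ 2 ≤ Cl * (2 * p t) := by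
      have h6 := hl _ (gap_ne_zero hμ Ω t) hz
      have h7 : 1 ≤ √‖μ - Ω t‖ * (2 * p t) := by
        have := hp' t
        rw [div_le_iff₀ (by positivity)] at this
        linarith
      calc 1 + ‖logGap Ω μ t‖ ^ 2
          ≤ (1 + ‖logGap Ω μ t‖ ^ 2) * (√‖μ - Ω t‖ * (2 * p t)) :=
            le_mul_of_one_le_right (by positivity) h7
        _ = ((1 + ‖logGap Ω μ t‖ ^ 2) * √‖μ - Ω t‖) * (2 * p t) := by ring
        _ ≤ Cl * (2 * p t) := mul_le_mul_of_nonneg_right h6 (by positivity)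
    have hk : (1 + R ^ 2 + 2 * B + B ^ 2) * (1 + ‖logGap Ω μ t‖ ^ 2)
        ≤ 2 * D * (B₅ + 1) * (-deriv Ω t * p t) := by
      have h6 : D * (2 * p t) ≤ D * (2 * p t) * ((B₅ + 1) * -deriv Ω t) :=
        le_mul_of_one_le_right (by positivity) hd
      have h7 := mul_le_mul_of_nonneg_left hlog
        (show (0 : ℝ) ≤ 1 + R ^ 2 + 2 * B + B ^ 2 by positivity)
      calc _ ≤ (1 + R ^ 2 + 2 * B + B ^ 2) * (Cl * (2 * p t)) := h7
        _ = D * (2 * p t) := by rw [hD]; ring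
        _ ≤ _ := h6
        _ = _ := by ring
    refine ⟨le_trans (by positivity) hk, ?_⟩
    refine (norm_stateDeriv_le hm ((h1 t ht).trans ?_) ((h2 t ht).trans ?_)).trans
      (mul_le_mul_of_nonneg_right hk (norm_nonneg _)) <;> linarith
  · intro s hs t ht
    have hlip : |Ω t - Ω s| ≤ (B₄ + 1) * |t - s| := by
      have := (convex_Icc S T).norm_image_sub_le_of_norm_hasDerivWithin_le
        (fun x _ => (hΩ.hasDerivAt x).hasDerivWithinAt) (fun x hx => h4 x hx) hs ht
      rw [Real.norm_eq_abs, Real.norm_eq_abs] at this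
      nlinarith [abs_nonneg (t - s)]
    have h6 := abs_sqrtPotential_sub_le (gap_im_pos hμ Ω t) (gap_im_pos hμ Ω s)
    have h7 : ‖μ - (Ω t : ℂ) - (μ - Ω s)‖ = |Ω t - Ω s| := by
      rw [sub_sub_sub_cancel_left, ← Complex.ofReal_sub, Complex.norm_real, Real.norm_eq_abs,
        abs_sub_comm]
    rw [h7] at h6
    have h8 : √|Ω t - Ω s| ≤ √(B₄ + 1) * √|t - s| := by
      rw [← Real.sqrt_mul (by positivity)]
      exact Real.sqrt_le_sqrt hlip
    rw [← mul_sub, abs_mul, abs_of_nonneg (by positivity), mul_assoc (2 * D * (B₅ + 1))]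
    refine mul_le_mul_of_nonneg_left ?_ (by positivity)
    linarith

theorem IsClassC.exists_state_bound (hΩ : IsClassC α Ω Ωinf a b) (S T R : ℝ) :
    ∃ C > 0, ∀ (m : ℝ) (μ : ℂ) (ψ : ℝ → ℂ), |m| ≤ R → ‖μ‖ ≤ R → 0 < μ.im →
      IsL2Solution Ω m μ ψ → ∀ s ∈ Set.Icc S T, ∀ t ∈ Set.Icc S T,
        ‖state Ω μ ψ t‖ ≤ C * ‖state Ω μ ψ s‖ ∧
        ‖state Ω μ ψ t - state Ω μ ψ s‖ ≤ C * √|t - s| * ‖state Ω μ ψ s‖ := by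
  obtain ⟨C, hC, h⟩ := hΩ.exists_comparison S T R
  set E := Real.exp (C * √|T - S|) with hE
  have hE1 : 1 ≤ E := Real.one_le_exp (by positivity)
  -- `E` serves the first bound and `C * E * E` the second; its extra `E` is needed when t < s, to
  -- move the base point from t to s.
  refine ⟨E + C * E * E, by positivity, fun m μ ψ hm hμR hμ hψ => ?_⟩
  obtain ⟨K, K', hK, hK', hKh⟩ := h m μ ψ hm hμR hμ
  have hX := hΩ.hasDerivAt_state hψ hμ
  have hKE : ∀ s ∈ Set.Icc S T, ∀ t ∈ Set.Icc S T, Real.exp (K t - K s) ≤ E := by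
    intro s hs t ht
    refine Real.exp_le_exp.2 ((le_abs_self _).trans ((hKh s hs t ht).trans ?_))
    refine mul_le_mul_of_nonneg_left (Real.sqrt_le_sqrt ?_) hC.le
    rw [abs_of_nonneg (by linarith [hs.1, hs.2] : 0 ≤ T - S), abs_le]
    constructor <;> linarith [hs.1, hs.2, ht.1, ht.2]
  have hsub : ∀ s ∈ Set.Icc S T, ∀ t ∈ Set.Icc S T, Set.Icc s t ⊆ Set.Icc S T := fun s hs t ht =>
    Set.Icc_subset_Icc hs.1 ht.2
  have hright : ∀ s ∈ Set.Icc S T, ∀ t ∈ Set.Icc S T, s ≤ t →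
      ‖state Ω μ ψ t‖ ≤ E * ‖state Ω μ ψ s‖ := by
    intro s hs t ht hst
    have h1 := norm_le_mul_exp_of_norm_deriv_le hst hX hK
      fun r hr => (hK' r (hsub s hs t ht hr)).2
    rw [mul_comm] at h1
    exact h1.trans (mul_le_mul_of_nonneg_right (hKE s hs t ht) (norm_nonneg _))
  have hleft : ∀ s ∈ Set.Icc S T, ∀ t ∈ Set.Icc S T, s ≤ t →
      ‖state Ω μ ψ s‖ ≤ E * ‖state Ω μ ψ t‖ := by
    intro s hs t ht hst
    have h1 := norm_le_mul_exp_of_norm_deriv_le_left hst hX hK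
      fun r hr => (hK' r (hsub s hs t ht hr)).2
    rw [mul_comm] at h1
    exact h1.trans (mul_le_mul_of_nonneg_right (hKE s hs t ht) (norm_nonneg _))
  have hdiff : ∀ s ∈ Set.Icc S T, ∀ t ∈ Set.Icc S T, s ≤ t →
      ‖state Ω μ ψ t - state Ω μ ψ s‖ ≤ C * E * √|t - s| * ‖state Ω μ ψ s‖ := by
    intro s hs t ht hst
    have h1 := norm_sub_le_of_norm_deriv_le_deriv hst hX
      (fun r => (hK r).const_mul (E * ‖state Ω μ ψ s‖)) fun r hr => by
        have hr' := hsub s hs t ht hr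
        have h2 := hright s hs r hr' hr.1
        calc _ ≤ K' r * ‖state Ω μ ψ r‖ := (hK' r hr').2
          _ ≤ K' r * (E * ‖state Ω μ ψ s‖) := mul_le_mul_of_nonneg_left h2 (hK' r hr').1
          _ = _ := mul_comm _ _
    rw [← mul_sub] at h1
    have h2 := mul_le_mul_of_nonneg_left ((le_abs_self _).trans (hKh s hs t ht))
      (show 0 ≤ E * ‖state Ω μ ψ s‖ by positivity)
    calc _ ≤ _ := h1
      _ ≤ _ := h2
      _ = _ := by ring
  intro s hs t ht
  have hN := norm_nonneg (state Ω μ ψ s)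
  have hCE : 0 ≤ C * E * E := by positivity
  have hq := Real.sqrt_nonneg |t - s|
  rcases le_total s t with hst | hst
  · refine ⟨(hright s hs t ht hst).trans (mul_le_mul_of_nonneg_right (by linarith) hN), ?_⟩
    refine (hdiff s hs t ht hst).trans (mul_le_mul_of_nonneg_right
      (mul_le_mul_of_nonneg_right ?_ hq) hN)
    nlinarith [mul_pos hC (lt_of_lt_of_le one_pos hE1)]
  · have h1 := hleft t ht s hs hst
    refine ⟨h1.trans (mul_le_mul_of_nonneg_right (by linarith) hN), ?_⟩
    have h2 := hdiff t ht s hs hst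
    rw [norm_sub_rev, abs_sub_comm] at h2
    have h3 := mul_le_mul_of_nonneg_left h1 (show 0 ≤ C * E * √|t - s| by positivity)
    calc _ ≤ _ := h2
      _ ≤ _ := h3
      _ = C * E * E * √|t - s| * ‖state Ω μ ψ s‖ := by ring
      _ ≤ _ := mul_le_mul_of_nonneg_right (mul_le_mul_of_nonneg_right (by linarith) hq) hN

theorem IsClassC.state_ne_zero (hΩ : IsClassC α Ω Ωinf a b) {m : ℝ} {μ : ℂ} {ψ : ℝ → ℂ}
    (hμ : 0 < μ.im) (h : IsL2Solution Ω m μ ψ) (hψ : ψ ≠ 0) (s : ℝ) : state Ω μ ψ s ≠ 0 := by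
  intro h0
  refine hψ (funext fun t => ?_)
  obtain ⟨C, -, hC⟩ := hΩ.exists_state_bound (min s t) (max s t) (max |m| ‖μ‖)
  have h1 := (hC m μ ψ (le_max_left _ _) (le_max_right _ _) hμ h s
    ⟨min_le_left _ _, le_max_left _ _⟩ t ⟨min_le_right _ _, le_max_right _ _⟩).1
  rw [h0, norm_zero, mul_zero] at h1
  have h2 : state Ω μ ψ t = 0 := norm_le_zero_iff.1 h1
  exact congrArg Prod.fst h2

theorem IsL2Solution.const_smul {m : ℝ} {μ : ℂ} {ψ : ℝ → ℂ} (h : IsL2Solution Ω m μ ψ) (c : ℂ) :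
    IsL2Solution Ω m μ (c • ψ) := by
  have h1 : deriv (c • ψ) = c • deriv ψ := funext fun t => deriv_const_smul_field c ψ
  have h2 : deriv (c • deriv ψ) = c • deriv (deriv ψ) :=
    funext fun t => deriv_const_smul_field c (deriv ψ)
  refine ⟨h.contDiff.const_smul c, h.memLp.const_smul c, fun t ht => ?_⟩
  rw [h1, h2]
  simp only [Pi.smul_apply, smul_eq_mul]
  linear_combination c * h.eqn t ht

theorem state_smul (Ω : ℝ → ℝ) (μ c : ℂ) (ψ : ℝ → ℂ) (t : ℝ) :
    state Ω μ (c • ψ) t = c • state Ω μ ψ t := by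
  have h1 : deriv (c • ψ) t = c • deriv ψ t := deriv_const_smul_field c ψ
  simp only [state, quasiDeriv, h1, Pi.smul_apply, Prod.smul_mk, smul_eq_mul]
  congr 1
  ring

theorem IsClassC.exists_normalized (hΩ : IsClassC α Ω Ωinf a b) {m : ℝ} {μ : ℂ}
    (h : μ ∈ unstableSet Ω m) (s : ℝ) :
    0 < μ.im ∧ ∃ ψ, IsL2Solution Ω m μ ψ ∧ ‖state Ω μ ψ s‖ = 1 := by
  obtain ⟨hμ, ψ, hψ, hsol⟩ := h
  refine ⟨hμ, ((‖state Ω μ ψ s‖⁻¹ : ℝ) : ℂ) • ψ, hsol.const_smul _, ?_⟩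
  have h0 := norm_ne_zero_iff.2 (hΩ.state_ne_zero hμ hsol hψ s)
  rw [state_smul, norm_smul, Complex.norm_real, norm_inv, norm_norm, inv_mul_cancel₀ h0]

end Bounds

section Asymptotics

variable {α : ℝ} {Ω : ℝ → ℝ} {Ωinf a b : ℝ}

/-! ### Asymptotics of the profile -/

theorem IsClassC.coeffA_eq_deriv_vorticity (hΩ : IsClassC α Ω Ωinf a b) :
    coeffA Ω = deriv (vorticity Ω) := by
  funext t
  exact (((hΩ.hasDerivAt_deriv t).add ((hΩ.hasDerivAt t).const_mul 2)).deriv).symm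

theorem hasDerivAt_exp_mul (c t : ℝ) :
    HasDerivAt (fun t => Real.exp (c * t)) (c * Real.exp (c * t)) t := by
  have := ((hasDerivAt_id t).const_mul c).exp
  exact this.congr_deriv (by simp [mul_comm])

theorem tendsto_exp_mul_atTop {c : ℝ} (hc : c < 0) :
    Tendsto (fun t => Real.exp (c * t)) atTop (𝓝 0) :=
  Real.tendsto_exp_atBot.comp (tendsto_id.const_mul_atTop_of_neg hc)

theorem tendsto_exp_mul_atBot {c : ℝ} (hc : 0 < c) :
    Tendsto (fun t => Real.exp (c * t)) atBot (𝓝 0) :=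
  Real.tendsto_exp_atBot.comp (tendsto_id.const_mul_atBot hc)

theorem IsClassC.tendsto_deriv_atBot (hΩ : IsClassC α Ω Ωinf a b) :
    Tendsto (deriv Ω) atBot (𝓝 0) ∧ Tendsto (coeffA Ω) atBot (𝓝 0) := by
  obtain ⟨M, M₁, c₀, -, -, -, h, -⟩ := hΩ.ends
  set ℓ := Real.log M₁
  have h1 : Set.EqOn (deriv Ω) (fun t => -c₀ * (2 * Real.exp (2 * t))) (Set.Iio ℓ) := by
    intro t ht
    have h2 : Ω =ᶠ[𝓝 t] fun t => Ωinf - c₀ * Real.exp (2 * t) := by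
      filter_upwards [Iio_mem_nhds ht] with s hs using h s hs.le
    rw [h2.deriv_eq]
    exact ((((hasDerivAt_exp_mul 2 t).const_mul c₀).const_sub Ωinf).congr_deriv (by ring)).deriv
  have h3 : Set.EqOn (deriv (deriv Ω)) (fun t => -c₀ * (2 * (2 * Real.exp (2 * t))))
      (Set.Iio ℓ) := by
    intro t ht
    have h2 : deriv Ω =ᶠ[𝓝 t] fun t => -c₀ * (2 * Real.exp (2 * t)) := by
      filter_upwards [Iio_mem_nhds ht] with s hs using h1 hs
    rw [h2.deriv_eq]
    exact (((hasDerivAt_exp_mul 2 t).const_mul 2).const_mul (-c₀)).deriv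
  have h0 := tendsto_exp_mul_atBot (c := 2) (by norm_num)
  have h4 : Tendsto (deriv Ω) atBot (𝓝 0) := by
    have := (h0.const_mul 2).const_mul (-c₀)
    rw [mul_zero, mul_zero] at this
    refine this.congr' ?_
    filter_upwards [eventually_lt_atBot ℓ] with t ht using (h1 ht).symm
  have h5 : Tendsto (deriv (deriv Ω)) atBot (𝓝 0) := by
    have := ((h0.const_mul 2).const_mul 2).const_mul (-c₀)
    rw [mul_zero, mul_zero, mul_zero] at this
    refine this.congr' ?_
    filter_upwards [eventually_lt_atBot ℓ] with t ht using (h3 ht).symm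
  refine ⟨h4, ?_⟩
  have := h5.add (h4.const_mul 2)
  rwa [mul_zero, add_zero] at this

/-- Beyond log M, (e^{2t} Ω)' = e^{(2-α)t}, so Ω = D e^{-2t} + e^{-αt}/(2-α). Only the upper bound
is recorded, since Ω > 0 supplies the lower one. -/
theorem IsClassC.tendsto_atTop (hΩ : IsClassC α Ω Ωinf a b) (hα0 : 0 < α) (hα2 : α < 2) :
    Tendsto Ω atTop (𝓝 0) ∧ Tendsto (deriv Ω) atTop (𝓝 0) ∧ Tendsto (coeffA Ω) atTop (𝓝 0) := by
  obtain ⟨M, M₁, c₀, -, -, -, -, h⟩ := hΩ.ends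
  set ℓ := Real.log M
  have h0 := tendsto_exp_mul_atTop (c := -α) (by linarith)
  have hg : ∀ t, HasDerivAt
      (fun t => Real.exp (2 * t) * Ω t - (2 - α)⁻¹ * Real.exp ((2 - α) * t))
      (2 * Real.exp (2 * t) * Ω t + Real.exp (2 * t) * deriv Ω t
        - (2 - α)⁻¹ * ((2 - α) * Real.exp ((2 - α) * t))) t := fun t =>
    ((hasDerivAt_exp_mul 2 t).mul (hΩ.hasDerivAt t)).sub
      ((hasDerivAt_exp_mul (2 - α) t).const_mul _)
  have hanti : AntitoneOn (fun t => Real.exp (2 * t) * Ω t - (2 - α)⁻¹ * Real.exp ((2 - α) * t))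
      (Set.Ici ℓ) := by
    refine antitoneOn_of_hasDerivWithinAt_nonpos (convex_Ici ℓ)
      (fun t ht => (hg t).continuousAt.continuousWithinAt)
      (fun t ht => (hg t).hasDerivWithinAt) (fun t ht => le_of_eq ?_)
    have h1 := h t (interior_subset ht)
    have h2 : (2 - α) ≠ 0 := by linarith
    have h3 : Real.exp ((2 - α) * t) = Real.exp (2 * t) * Real.exp (-α * t) := by
      rw [← Real.exp_add]; ring_nf
    rw [vorticity] at h1
    rw [h3, ← h1]
    field_simp
    ring
  set D := Real.exp (2 * ℓ) * Ω ℓ - (2 - α)⁻¹ * Real.exp ((2 - α) * ℓ)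
  have hle : ∀ t ≥ ℓ, Ω t ≤ D * Real.exp (-2 * t) + (2 - α)⁻¹ * Real.exp (-α * t) := by
    intro t ht
    have h1 : Real.exp (2 * t) * Ω t - (2 - α)⁻¹ * Real.exp ((2 - α) * t) ≤ D :=
      hanti Set.self_mem_Ici ht ht
    have h3 : Real.exp (-α * t) = Real.exp ((2 - α) * t) * Real.exp (-2 * t) := by
      rw [← Real.exp_add]; ring_nf
    have h4 : Real.exp (2 * t) * Real.exp (-2 * t) = 1 := by
      rw [← Real.exp_add]; simp
    have h5 := mul_le_mul_of_nonneg_right h1 (Real.exp_pos (-2 * t)).le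
    rw [h3]
    have h6 : Ω t = Ω t * (Real.exp (2 * t) * Real.exp (-2 * t)) := by rw [h4, mul_one]
    rw [h6]
    linarith
  have hΩ0 : Tendsto Ω atTop (𝓝 0) := by
    have h1 := ((tendsto_exp_mul_atTop (c := -2) (by norm_num)).const_mul D).add
      (h0.const_mul (2 - α)⁻¹)
    rw [mul_zero, mul_zero, add_zero] at h1
    refine tendsto_of_tendsto_of_tendsto_of_le_of_le' tendsto_const_nhds h1
      (Eventually.of_forall fun t => (hΩ.pos t).le) ?_
    filter_upwards [eventually_ge_atTop ℓ] with t ht using hle t ht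
  refine ⟨hΩ0, ?_, ?_⟩
  · have := h0.sub (hΩ0.const_mul 2)
    rw [mul_zero, sub_zero] at this
    refine this.congr' ?_
    filter_upwards [eventually_ge_atTop ℓ] with t ht
    rw [← h t ht, vorticity]; ring
  · have := h0.const_mul (-α)
    rw [mul_zero] at this
    refine this.congr' ?_
    filter_upwards [eventually_gt_atTop ℓ] with t ht
    have h2 : vorticity Ω =ᶠ[𝓝 t] fun t => Real.exp (-α * t) := by
      filter_upwards [Ioi_mem_nhds ht] with s hs using h s hs.le
    rw [hΩ.coeffA_eq_deriv_vorticity, h2.deriv_eq, (hasDerivAt_exp_mul (-α) t).deriv]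

theorem IsClassC.exists_eq (hΩ : IsClassC α Ω Ωinf a b) (hα0 : 0 < α) (hα2 : α < 2) {μ₀ : ℝ}
    (hμ₀ : 0 < μ₀) (hμ₀' : μ₀ < Ωinf) : ∃ d, Ω d = μ₀ := by
  obtain ⟨s, hs⟩ := ((hΩ.tendsto_atTop hα0 hα2).1.eventually_lt_const hμ₀).exists
  obtain ⟨t, ht⟩ := (hΩ.tendsto_atBot.eventually_const_lt hμ₀').exists
  exact mem_range_of_exists_le_of_exists_ge hΩ.smooth.continuous ⟨s, hs.le⟩ ⟨t, ht.le⟩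

theorem IsClassC.exists_tail (hΩ : IsClassC α Ω Ωinf a b) (hα0 : 0 < α) (hα2 : α < 2) {μ₀ : ℝ}
    (hμ₀ : 0 < μ₀) (hμ₀' : μ₀ < Ωinf) :
    ∃ T > 0, ∃ η > 0, ∀ t, T ≤ |t| → ∀ μ : ℂ, ‖μ - μ₀‖ ≤ η →
      ‖(coeffA Ω t : ℂ) / (Ω t - μ)‖ ≤ 1 / 4 := by
  -- At both ends Ω is at least 2η away from μ₀, hence η away from μ, while |A| < η/4; this gives
  -- the ratio 1/4.
  set η := min μ₀ (Ωinf - μ₀) / 4 with hη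
  have hη0 : 0 < η := by
    have : 0 < min μ₀ (Ωinf - μ₀) := lt_min hμ₀ (by linarith)
    positivity
  have hη1 : 4 * η ≤ μ₀ := by rw [hη]; linarith [min_le_left μ₀ (Ωinf - μ₀)]
  have hη2 : 4 * η ≤ Ωinf - μ₀ := by rw [hη]; linarith [min_le_right μ₀ (Ωinf - μ₀)]
  obtain ⟨h1, -, h2⟩ := hΩ.tendsto_atTop hα0 hα2
  have h3 := hΩ.tendsto_atBot
  have h4 := hΩ.tendsto_deriv_atBot.2
  have hA : ∀ {l : Filter ℝ}, Tendsto (coeffA Ω) l (𝓝 0) → ∀ᶠ t in l, |coeffA Ω t| < η / 4 := by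
    intro l hl
    have := hl.abs
    rw [abs_zero] at this
    exact this.eventually_lt_const (by positivity)
  have htop : ∀ᶠ t in atTop, |coeffA Ω t| < η / 4 ∧ 2 * η ≤ |Ω t - μ₀| := by
    filter_upwards [hA h2, h1.eventually_lt_const hη0] with t ht ht'
    refine ⟨ht, ?_⟩
    rw [abs_sub_comm]
    exact le_trans (by linarith) (le_abs_self _)
  have hbot : ∀ᶠ t in atBot, |coeffA Ω t| < η / 4 ∧ 2 * η ≤ |Ω t - μ₀| := by
    filter_upwards [hA h4, h3.eventually_const_lt (show Ωinf - η < Ωinf by linarith)] with t ht ht'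
    exact ⟨ht, le_trans (by linarith) (le_abs_self _)⟩
  obtain ⟨T₁, hT₁⟩ := eventually_atTop.1 htop
  obtain ⟨T₂, hT₂⟩ := eventually_atBot.1 hbot
  refine ⟨max 1 (max T₁ (-T₂)), by positivity, η, hη0, fun t ht μ hμ => ?_⟩
  have h5 : |coeffA Ω t| < η / 4 ∧ 2 * η ≤ |Ω t - μ₀| := by
    have h6 : T₁ ≤ |t| := (le_max_left _ _).trans ((le_max_right _ _).trans ht)
    have h7 : -T₂ ≤ |t| := (le_max_right _ _).trans ((le_max_right _ _).trans ht)
    rcases abs_cases t with ⟨h8, -⟩ | ⟨h8, -⟩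
    · exact hT₁ t (h8 ▸ h6)
    · exact hT₂ t (by linarith)
  have h6 : η ≤ ‖(Ω t : ℂ) - μ‖ := by
    have h7 : ‖(Ω t : ℂ) - μ₀‖ = |Ω t - μ₀| := by
      rw [← Complex.ofReal_sub, Complex.norm_real, Real.norm_eq_abs]
    have h8 : (Ω t : ℂ) - μ₀ = (Ω t - μ) + (μ - μ₀) := by ring
    have h9 := norm_add_le ((Ω t : ℂ) - μ) (μ - μ₀)
    rw [← h8, h7] at h9
    linarith [h5.2]
  rw [norm_div, Complex.norm_real, Real.norm_eq_abs, div_le_iff₀ (by linarith)]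
  linarith [h5.1]

/-! ### Uniform decay of solutions -/

/-- The second derivative of |ψ|² is 2 Re κ |ψ|² + 2|φ|² ≥ |ψ|², and |ψ|² is integrable. -/
theorem norm_sq_le_mul_exp {ψ φ κ : ℝ → ℂ} {T : ℝ} (h1 : ∀ t, HasDerivAt ψ (φ t) t)
    (h2 : ∀ t, HasDerivAt φ (κ t * ψ t) t) (hκ : ∀ t ≥ T, 1 / 2 ≤ (κ t).re)
    (hψ : MemLp ψ 2) {t : ℝ} (ht : T ≤ t) :
    ‖ψ t‖ ^ 2 ≤ ‖ψ T‖ ^ 2 * Real.exp (-(t - T)) := by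
  refine le_mul_exp_of_integrableOn_Ici (f := fun t => ‖ψ t‖ ^ 2)
    (f' := fun t => 2 * inner ℝ (ψ t) (φ t))
    (f'' := fun t => 2 * (inner ℝ (ψ t) (κ t * ψ t) + inner ℝ (φ t) (φ t)))
    (fun t => (h1 t).norm_sq) (fun t _ => ((h1 t).inner ℝ (h2 t)).const_mul 2) ?_ ?_ ht
  · intro t ht
    have h3 : inner ℝ (ψ t) (κ t * ψ t) = (κ t).re * ‖ψ t‖ ^ 2 := by
      rw [Complex.inner, Complex.sq_norm, Complex.normSq_apply]
      simp
      ring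
    have h4 : 0 ≤ inner ℝ (φ t) (φ t) := real_inner_self_nonneg
    have h5 := mul_le_mul_of_nonneg_right (hκ t ht) (sq_nonneg ‖ψ t‖)
    rw [h3]
    linarith
  · exact hψ.norm.integrable_sq

/-- The thresholds 3/4 and 1/4 leave a potential of real part at least 1/2. The left half-line is
reduced to the right one by reflection. -/
theorem IsL2Solution.norm_sq_le_mul_exp {m : ℝ} {μ : ℂ} {ψ : ℝ → ℂ} (h : IsL2Solution Ω m μ ψ)
    (hμ : 0 < μ.im) {T N : ℝ} (hm : 3 / 4 ≤ m ^ 2)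
    (htail : ∀ t, T ≤ |t| → ‖(coeffA Ω t : ℂ) / (Ω t - μ)‖ ≤ 1 / 4)
    (hN : ‖ψ T‖ ≤ N) (hN' : ‖ψ (-T)‖ ≤ N) {t : ℝ} (ht : T ≤ |t|) :
    ‖ψ t‖ ^ 2 ≤ N ^ 2 * Real.exp (-(|t| - T)) := by
  have hκ : ∀ t, T ≤ |t| → 1 / 2 ≤ ((m : ℂ) ^ 2 + coeffA Ω t / (Ω t - μ)).re := by
    intro t ht
    have h1 := (abs_le.1 ((Complex.abs_re_le_norm _).trans (htail t ht))).1
    rw [Complex.add_re, ← Complex.ofReal_pow, Complex.ofReal_re]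
    linarith
  rcases abs_cases t with ⟨h8, -⟩ | ⟨h8, -⟩
  · rw [h8] at ht ⊢
    have h1 := RadialFlow.norm_sq_le_mul_exp h.hasDerivAt (h.hasDerivAt_deriv hμ)
      (fun s hs => hκ s (hs.le.trans (le_abs_self s))) h.memLp ht
    exact h1.trans (mul_le_mul_of_nonneg_right (pow_le_pow_left₀ (norm_nonneg _) hN 2)
      (Real.exp_pos _).le)
  · rw [h8] at ht ⊢
    have hn : ∀ r : ℝ, HasDerivAt (fun r : ℝ => -r) (-1) r := fun r => (hasDerivAt_id r).neg
    have h1 := RadialFlow.norm_sq_le_mul_exp (ψ := fun t => ψ (-t))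
      (φ := fun t => -deriv ψ (-t))
      (κ := fun t => (m : ℂ) ^ 2 + coeffA Ω (-t) / (Ω (-t) - μ)) (T := T)
      (fun s => ((h.hasDerivAt (-s)).scomp s (hn s)).congr_deriv (by simp))
      (fun s => ((h.hasDerivAt_deriv hμ (-s)).scomp s (hn s)).neg.congr_deriv (by simp))
      (fun s hs => hκ (-s) (by rw [abs_neg]; exact hs.le.trans (le_abs_self s)))
      (h.memLp.comp_measurePreserving (Measure.measurePreserving_neg volume)) ht
    simp only [neg_neg] at h1
    exact h1.trans (mul_le_mul_of_nonneg_right (pow_le_pow_left₀ (norm_nonneg _) hN' 2)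
      (Real.exp_pos _).le)

/-! ### Bounds away from the singular point -/

/-- The third derivative of a solution. -/
noncomputable def thirdDeriv (Ω : ℝ → ℝ) (m : ℝ) (μ : ℂ) (ψ : ℝ → ℂ) (t : ℝ) : ℂ :=
  ((deriv (coeffA Ω) t : ℝ) * (Ω t - μ) - coeffA Ω t * (deriv Ω t : ℝ)) / (Ω t - μ) ^ 2 * ψ t
    + (m ^ 2 + coeffA Ω t / (Ω t - μ)) * deriv ψ t

theorem IsClassC.hasDerivAt_secondDeriv (hΩ : IsClassC α Ω Ωinf a b) {m : ℝ} {μ : ℂ} {ψ : ℝ → ℂ}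
    (h : IsL2Solution Ω m μ ψ) (hμ : 0 < μ.im) (t : ℝ) :
    HasDerivAt (fun t => ((m : ℂ) ^ 2 + coeffA Ω t / (Ω t - μ)) * ψ t)
      (thirdDeriv Ω m μ ψ t) t := by
  have hne : (Ω t : ℂ) - μ ≠ 0 := by
    rw [← neg_sub]; exact neg_ne_zero.2 (gap_ne_zero hμ Ω t)
  exact ((((hΩ.hasDerivAt_coeffA t).ofReal_comp.div ((hΩ.hasDerivAt t).ofReal_comp.sub_const μ)
    hne).const_add ((m : ℂ) ^ 2)).mul (h.hasDerivAt t))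

/-- Away from the singular point the coefficients are uniformly smooth. These bounds on ψ'' and ψ'''
control the Taylor remainders of ψ and ψ' in the passage to the limit. -/
theorem IsClassC.exists_deriv_bound (hΩ : IsClassC α Ω Ωinf a b) {S T R N η μ₀ : ℝ} (hη : 0 < η)
    (hgap : ∀ t ∈ Set.Icc S T, 2 * η ≤ |Ω t - μ₀|) :
    ∃ C, ∀ (m : ℝ) (μ : ℂ) (ψ : ℝ → ℂ), |m| ≤ R → ‖μ‖ ≤ R → ‖μ - μ₀‖ ≤ η → 0 < μ.im →
      (∀ t ∈ Set.Icc S T, ‖state Ω μ ψ t‖ ≤ N) → ∀ t ∈ Set.Icc S T,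
        ‖((m : ℂ) ^ 2 + coeffA Ω t / (Ω t - μ)) * ψ t‖ ≤ C ∧ ‖thirdDeriv Ω m μ ψ t‖ ≤ C := by
  obtain ⟨B₁, hB₁, h1⟩ := exists_abs_le_Icc hΩ.contDiff_slopeRatio.continuous S T
  obtain ⟨B₂, hB₂, h2⟩ := exists_abs_le_Icc hΩ.contDiff_coeffA.continuous S T
  obtain ⟨B₃, hB₃, h3⟩ := exists_abs_le_Icc hΩ.smooth.continuous S T
  obtain ⟨B₄, hB₄, h4⟩ := exists_abs_le_Icc hΩ.contDiff_deriv.continuous S T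
  obtain ⟨B₅, hB₅, h5⟩ := exists_abs_le_Icc
    ((contDiff_infty_iff_deriv.1 hΩ.contDiff_coeffA).2).continuous S T
  obtain ⟨Cl, hCl, hl⟩ := exists_norm_log_sq_mul_sqrt_le (R + B₃)
  set Q := R ^ 2 + B₂ / η with hQ
  have hQ0 : 0 ≤ Q := by positivity
  set P := (B₅ * (B₃ + R) + B₂ * B₄) / η ^ 2 with hP
  set V := N + B₁ * (Cl / √η) * N with hV
  refine ⟨Q * N + (P * N + Q * V), fun m μ ψ hm hμR hμη hμ hN t ht => ?_⟩
  have hR : 0 ≤ R := (abs_nonneg m).trans hm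
  have hN0 : 0 ≤ N := (norm_nonneg _).trans (hN t ht)
  have hP0 : 0 ≤ P := by positivity
  have hV0 : 0 ≤ V := by positivity
  have hψ : ‖ψ t‖ ≤ N := (norm_fst_le (state Ω μ ψ t)).trans (hN t ht)
  have hv : ‖quasiDeriv Ω μ ψ t‖ ≤ N := (norm_snd_le (state Ω μ ψ t)).trans (hN t ht)
  have hgapμ : η ≤ ‖(Ω t : ℂ) - μ‖ := by
    have h7 : ‖(Ω t : ℂ) - μ₀‖ = |Ω t - μ₀| := by
      rw [← Complex.ofReal_sub, Complex.norm_real, Real.norm_eq_abs]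
    have h8 : (Ω t : ℂ) - μ₀ = (Ω t - μ) + (μ - μ₀) := by ring
    have h9 := norm_add_le ((Ω t : ℂ) - μ) (μ - μ₀)
    rw [← h8, h7] at h9
    linarith [hgap t ht]
  have hgapR : ‖(Ω t : ℂ) - μ‖ ≤ B₃ + R := by
    refine (norm_sub_le _ _).trans (add_le_add ?_ hμR)
    rw [Complex.norm_real]; exact h3 t ht
  have hq : ‖(m : ℂ) ^ 2 + coeffA Ω t / (Ω t - μ)‖ ≤ Q := by
    refine (norm_add_le _ _).trans (add_le_add ?_ ?_)
    · rw [norm_pow, Complex.norm_real]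
      exact pow_le_pow_left₀ (abs_nonneg _) hm 2
    · rw [norm_div, Complex.norm_real]
      exact div_le_div₀ hB₂ (h2 t ht) hη hgapμ
  have hq' : ‖(((deriv (coeffA Ω) t : ℝ) : ℂ) * (Ω t - μ) - coeffA Ω t * (deriv Ω t : ℝ))
      / (Ω t - μ) ^ 2‖ ≤ P := by
    rw [norm_div, norm_pow]
    refine div_le_div₀ (by positivity) ?_ (by positivity) (pow_le_pow_left₀ hη.le hgapμ 2)
    refine (norm_sub_le _ _).trans (add_le_add ?_ ?_)
    · rw [norm_mul, Complex.norm_real]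
      exact mul_le_mul (h5 t ht) hgapR (norm_nonneg _) hB₅
    · rw [norm_mul, Complex.norm_real, Complex.norm_real]
      exact mul_le_mul (h2 t ht) (h4 t ht) (norm_nonneg _) hB₂
  have hL : ‖logGap Ω μ t‖ ≤ Cl / √η := by
    have h6 := hl _ (gap_ne_zero hμ Ω t)
      (by rw [norm_sub_rev]; exact hgapR.trans (by linarith))
    rw [le_div_iff₀ (by positivity)]
    have h7 : √η ≤ √‖μ - Ω t‖ := Real.sqrt_le_sqrt (by rw [norm_sub_rev]; exact hgapμ)
    have h8 : ‖logGap Ω μ t‖ ≤ 1 + ‖Complex.log (μ - Ω t)‖ ^ 2 := by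
      rw [logGap]; nlinarith [sq_nonneg (‖Complex.log (μ - Ω t)‖ - 1)]
    exact (mul_le_mul h8 h7 (by positivity) (by positivity)).trans h6
  have hψ' : ‖deriv ψ t‖ ≤ V := by
    have h6 : deriv ψ t = quasiDeriv Ω μ ψ t + slopeRatio Ω t * logGap Ω μ t * ψ t := by
      simp [quasiDeriv]
    rw [h6]
    refine (norm_add_le _ _).trans (add_le_add hv ?_)
    rw [norm_mul, norm_mul, Complex.norm_real]
    exact mul_le_mul (mul_le_mul (h1 t ht) hL (norm_nonneg _) hB₁) hψ (norm_nonneg _)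
      (by positivity)
  have h6 : ‖((m : ℂ) ^ 2 + coeffA Ω t / (Ω t - μ)) * ψ t‖ ≤ Q * N := by
    rw [norm_mul]; exact mul_le_mul hq hψ (norm_nonneg _) hQ0
  have h7 : ‖thirdDeriv Ω m μ ψ t‖ ≤ P * N + Q * V := by
    refine (norm_add_le _ _).trans (add_le_add ?_ ?_)
    · rw [norm_mul]; exact mul_le_mul hq' hψ (norm_nonneg _) hP0
    · rw [norm_mul]; exact mul_le_mul hq hψ' (norm_nonneg _) hQ0
  have h8 : 0 ≤ Q * N := by positivity
  have h9 : 0 ≤ P * N + Q * V := by positivity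
  exact ⟨by linarith, by linarith⟩

end Asymptotics

/-! ### The limiting solution -/

/-- A solution of the limiting equation off the singular point `d`, with the regularity across `d`
that limits of unstable modes have. -/
structure IsLimitMode (Ω : ℝ → ℝ) (m μ d : ℝ) (ψ v : ℝ → ℂ) : Prop where
  norm_eq_one : ‖(ψ d, v d)‖ = 1
  holder : ∃ C, ∀ t ∈ Set.Icc (d - 1) (d + 1), ‖(ψ t, v t) - (ψ d, v d)‖ ≤ C * √|t - d|
  hasDerivAt : ∀ t ≠ d, HasDerivAt ψ (v t + slopeRatio Ω t * logGap Ω μ t * ψ t) t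
  hasDerivAt_deriv : ∀ t ≠ d, HasDerivAt (fun t => v t + slopeRatio Ω t * logGap Ω μ t * ψ t)
    (((m : ℂ) ^ 2 + coeffA Ω t / (Ω t - μ)) * ψ t) t
  decay : ∃ C, ∀ t, ‖ψ t‖ ≤ C * Real.exp (-(1 / 2) * |t|)

/-- The principal logarithm is continuous from the closed upper half-plane up to the negative axis,
where its imaginary part is π. The sign of Im μ thus fixes the branch in the limit. -/
theorem tendsto_logGap {ι : Type*} {l : Filter ι} {Ω : ℝ → ℝ} {μ : ι → ℂ} {μ₀ : ℝ}
    (hμ : Tendsto μ l (𝓝 μ₀)) (him : ∀ᶠ i in l, 0 < (μ i).im) {t : ℝ} (ht : Ω t ≠ μ₀) :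
    Tendsto (fun i => logGap Ω (μ i) t) l (𝓝 (logGap Ω μ₀ t)) := by
  have h1 : Tendsto (fun i => μ i - (Ω t : ℂ)) l (𝓝 ((μ₀ : ℂ) - Ω t)) := hμ.sub_const _
  have h2 : ContinuousWithinAt Complex.log {z : ℂ | 0 ≤ z.im} ((μ₀ : ℂ) - Ω t) := by
    rcases lt_or_gt_of_ne ht with h | h
    · refine (continuousAt_clog (Or.inl ?_)).continuousWithinAt
      simpa using h
    · refine Complex.continuousWithinAt_log_of_re_neg_of_im_zero ?_ ?_
      · simpa using h
      · simp
  refine Tendsto.comp (f := fun i => μ i - (Ω t : ℂ)) h2 (tendsto_nhdsWithin_iff.2 ⟨h1, ?_⟩)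
  filter_upwards [him] with i hi
  simpa using hi.le

/-- An ultrafilter makes the bounded states converge at every `t` at once, replacing a diagonal
extraction. The Hölder bound, the decay and the Taylor bounds then pass to the pointwise limit. -/
theorem IsClassC.exists_isLimitMode {α : ℝ} {Ω : ℝ → ℝ} {Ωinf a b : ℝ}
    (hΩ : IsClassC α Ω Ωinf a b) (hα0 : 0 < α) (hα2 : α < 2) {m₀ μ₀ d : ℝ} (hm₀ : 1 ≤ m₀)
    (hμ₀ : 0 < μ₀) (hμ₀' : μ₀ < Ωinf) (hd : Ω d = μ₀)
    (hlim : AccPt ((m₀, (μ₀ : ℂ)) : ℝ × ℂ) (𝓟 (unstablePairs Ω))) :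
    ∃ ψ v, IsLimitMode Ω m₀ μ₀ d ψ v := by
  have : (𝓝[≠] ((m₀, (μ₀ : ℂ)) : ℝ × ℂ) ⊓ 𝓟 (unstablePairs Ω)).NeBot := hlim
  set U : Ultrafilter (ℝ × ℂ) :=
    Ultrafilter.of (𝓝[≠] ((m₀, (μ₀ : ℂ)) : ℝ × ℂ) ⊓ 𝓟 (unstablePairs Ω)) with hU
  have hUl : (U : Filter (ℝ × ℂ)) ≤ 𝓝[≠] ((m₀, (μ₀ : ℂ)) : ℝ × ℂ) ⊓ 𝓟 (unstablePairs Ω) :=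
    Ultrafilter.of_le _
  have hUn : (U : Filter (ℝ × ℂ)) ≤ 𝓝 (m₀, (μ₀ : ℂ)) :=
    hUl.trans (inf_le_left.trans nhdsWithin_le_nhds)
  have hUp : ∀ᶠ p in (U : Filter (ℝ × ℂ)), p ∈ unstablePairs Ω :=
    le_principal_iff.1 (hUl.trans inf_le_right)
  have hm : Tendsto Prod.fst (U : Filter (ℝ × ℂ)) (𝓝 m₀) :=
    (continuous_fst.tendsto (m₀, (μ₀ : ℂ))).mono_left hUn
  have hμ : Tendsto Prod.snd (U : Filter (ℝ × ℂ)) (𝓝 (μ₀ : ℂ)) :=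
    (continuous_snd.tendsto (m₀, (μ₀ : ℂ))).mono_left hUn
  clear_value U
  clear hU hUl
  -- The value 0 off the unstable pairs is a dummy: the ultrafilter is concentrated on those pairs.
  have hex : ∀ p : ℝ × ℂ, ∃ ψ : ℝ → ℂ, p ∈ unstablePairs Ω →
      IsL2Solution Ω p.1 p.2 ψ ∧ ‖state Ω p.2 ψ d‖ = 1 := by
    intro p
    by_cases hp : p ∈ unstablePairs Ω
    · obtain ⟨-, ψ, h⟩ := hΩ.exists_normalized hp.2 d
      exact ⟨ψ, fun _ => h⟩
    · exact ⟨0, fun h => absurd h hp⟩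
  choose Ψ hΨ using hex
  have him : ∀ᶠ p in (U : Filter (ℝ × ℂ)), 0 < p.2.im := hUp.mono fun p hp => hp.2.1
  set R := max (m₀ + 1) (μ₀ + 1) with hR
  have hmR : ∀ᶠ p in (U : Filter (ℝ × ℂ)), |p.1| ≤ R := by
    have := hm.abs.eventually_lt_const (show |m₀| < m₀ + 1 by
      rw [abs_of_pos (by linarith)]; linarith)
    filter_upwards [this] with p hp using hp.le.trans (le_max_left _ _)
  have hμR : ∀ᶠ p in (U : Filter (ℝ × ℂ)), ‖p.2‖ ≤ R := by
    have := hμ.norm.eventually_lt_const (show ‖(μ₀ : ℂ)‖ < μ₀ + 1 by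
      rw [Complex.norm_real, Real.norm_of_nonneg hμ₀.le]; linarith)
    filter_upwards [this] with p hp using hp.le.trans (le_max_right _ _)
  have hμη : ∀ η > 0, ∀ᶠ p in (U : Filter (ℝ × ℂ)), ‖p.2 - (μ₀ : ℂ)‖ ≤ η := by
    intro η hη
    have h1 := hμ.eventually (Metric.closedBall_mem_nhds (μ₀ : ℂ) hη)
    filter_upwards [h1] with p hp
    rwa [← dist_eq_norm]
  have hm34 : ∀ᶠ p in (U : Filter (ℝ × ℂ)), 3 / 4 ≤ p.1 ^ 2 := by
    have := (hm.pow 2).eventually_const_lt (show 3 / 4 < m₀ ^ 2 by nlinarith)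
    filter_upwards [this] with p hp using hp.le
  -- uniform bounds on compact intervals containing `d`
  have hbd : ∀ S T : ℝ, d ∈ Set.Icc S T → ∃ C, 0 < C ∧ ∀ᶠ p in (U : Filter (ℝ × ℂ)),
      ∀ t ∈ Set.Icc S T, ‖state Ω p.2 (Ψ p) t‖ ≤ C ∧
        ‖state Ω p.2 (Ψ p) t - state Ω p.2 (Ψ p) d‖ ≤ C * √|t - d| := by
    intro S T hST
    obtain ⟨C, hC, h⟩ := hΩ.exists_state_bound S T R
    refine ⟨C, hC, ?_⟩
    filter_upwards [hUp, hmR, hμR, him] with p hp h1 h2 h3 t ht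
    obtain ⟨h4, h5⟩ := hΨ p hp
    have h6 := h p.1 p.2 (Ψ p) h1 h2 h3 h4 d hST t ht
    rwa [h5, mul_one, mul_one] at h6
  -- pointwise limits
  have hptw : ∀ t, ∃ x : ℂ × ℂ,
      Tendsto (fun p => state Ω p.2 (Ψ p) t) (U : Filter (ℝ × ℂ)) (𝓝 x) := by
    intro t
    obtain ⟨C, -, hC⟩ := hbd (min d t) (max d t) ⟨min_le_left _ _, le_max_left _ _⟩
    have h1 : ∀ᶠ p in (U : Filter (ℝ × ℂ)),
        state Ω p.2 (Ψ p) t ∈ Metric.closedBall (0 : ℂ × ℂ) C := by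
      filter_upwards [hC] with p hp
      rw [mem_closedBall_zero_iff]
      exact (hp t ⟨min_le_right _ _, le_max_right _ _⟩).1
    have h2 : (U.map fun p => state Ω p.2 (Ψ p) t : Filter (ℂ × ℂ)) ≤
        𝓟 (Metric.closedBall (0 : ℂ × ℂ) C) := by
      rw [Ultrafilter.coe_map, le_principal_iff, mem_map]
      exact h1
    obtain ⟨x, -, hx⟩ := (isCompact_closedBall (0 : ℂ × ℂ) C).ultrafilter_le_nhds _ h2
    rw [Ultrafilter.coe_map] at hx
    exact ⟨x, hx⟩
  choose X hX using hptw
  have hXψ : ∀ t, Tendsto (fun p => Ψ p t) (U : Filter (ℝ × ℂ)) (𝓝 (X t).1) := fun t =>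
    (continuous_fst.tendsto (X t)).comp (hX t)
  have hXv : ∀ t, Tendsto (fun p => quasiDeriv Ω p.2 (Ψ p) t) (U : Filter (ℝ × ℂ)) (𝓝 (X t).2) :=
    fun t => (continuous_snd.tendsto (X t)).comp (hX t)
  have hne : ∀ t ≠ d, Ω t ≠ μ₀ := fun t ht h => ht (hΩ.strictAnti.injective (h.trans hd.symm))
  have hXφ : ∀ t ≠ d, Tendsto (fun p => deriv (Ψ p) t) (U : Filter (ℝ × ℂ))
      (𝓝 ((X t).2 + slopeRatio Ω t * logGap Ω μ₀ t * (X t).1)) := by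
    intro t ht
    have h1 := (hXv t).add (((tendsto_logGap hμ him (hne t ht)).const_mul
      (slopeRatio Ω t : ℂ)).mul (hXψ t))
    refine h1.congr fun p => ?_
    simp [quasiDeriv]
  have hXχ : ∀ t ≠ d, Tendsto (fun p => ((p.1 : ℂ) ^ 2 + coeffA Ω t / (Ω t - p.2)) * Ψ p t)
      (U : Filter (ℝ × ℂ)) (𝓝 (((m₀ : ℂ) ^ 2 + coeffA Ω t / (Ω t - μ₀)) * (X t).1)) := by
    intro t ht
    have h0 : (Ω t : ℂ) - μ₀ ≠ 0 := by
      rw [← Complex.ofReal_sub]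
      exact_mod_cast sub_ne_zero.2 (hne t ht)
    exact ((((Complex.continuous_ofReal.tendsto m₀).comp hm).pow 2).add
      (tendsto_const_nhds.div (hμ.const_sub _) h0)).mul (hXψ t)
  -- Taylor bounds off `d`
  have htaylor : ∀ t ≠ d, ∃ r > 0, (∀ s ∈ Metric.ball t r, s ≠ d) ∧ ∃ C,
      ∀ᶠ p in (U : Filter (ℝ × ℂ)), ∀ s ∈ Metric.ball t r,
        ‖Ψ p s - Ψ p t - (s - t) • deriv (Ψ p) t‖ ≤ C * |s - t| * |s - t| ∧
        ‖deriv (Ψ p) s - deriv (Ψ p) t -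
          (s - t) • (((p.1 : ℂ) ^ 2 + coeffA Ω t / (Ω t - p.2)) * Ψ p t)‖
            ≤ C * |s - t| * |s - t| := by
    intro t ht
    -- Half the distance to `d` keeps the closed interval around `t` off the singular point.
    set r := |t - d| / 2 with hr
    have hr0 : 0 < r := by
      have := abs_pos.2 (sub_ne_zero.2 ht)
      positivity
    have hrd : ∀ s ∈ Set.Icc (t - r) (t + r), s ≠ d := by
      rintro s ⟨h1, h2⟩ rfl
      have : |t - s| ≤ r := abs_le.2 ⟨by linarith, by linarith⟩
      linarith
    have hball : ∀ s ∈ Metric.ball t r, s ∈ Set.Icc (t - r) (t + r) := by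
      intro s hs
      rw [Real.ball_eq_Ioo] at hs
      exact ⟨hs.1.le, hs.2.le⟩
    obtain ⟨η, hη, hgap⟩ : ∃ η > 0, ∀ s ∈ Set.Icc (t - r) (t + r), 2 * η ≤ |Ω s - μ₀| := by
      obtain ⟨s₀, hs₀, hmin⟩ := (isCompact_Icc (a := t - r) (b := t + r)).exists_isMinOn
        ⟨t, by constructor <;> linarith⟩
        (f := fun s => |Ω s - μ₀|) ((hΩ.smooth.continuous.sub continuous_const).abs.continuousOn)
      have h1 : 0 < |Ω s₀ - μ₀| := abs_pos.2 (sub_ne_zero.2 (hne s₀ (hrd s₀ hs₀)))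
      refine ⟨|Ω s₀ - μ₀| / 2, by positivity, fun s hs => ?_⟩
      have : |Ω s₀ - μ₀| ≤ |Ω s - μ₀| := hmin hs
      linarith
    obtain ⟨N, -, hN⟩ := hbd (min d (t - r)) (max d (t + r))
      ⟨min_le_left _ _, le_max_left _ _⟩
    obtain ⟨C, hC⟩ := hΩ.exists_deriv_bound (R := R) (N := N) hη hgap
    refine ⟨r, hr0, fun s hs => hrd s (hball s hs), C, ?_⟩
    filter_upwards [hUp, hmR, hμR, him, hμη η hη, hN] with p hp h1 h2 h3 h4 h5 s hs
    have hsol := (hΨ p hp).1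
    have h6 := hC p.1 p.2 (Ψ p) h1 h2 h4 h3 fun s hs => (h5 s
      ⟨(min_le_right _ _).trans hs.1, hs.2.trans (le_max_right _ _)⟩).1
    exact ⟨norm_taylor_one_le (fun s _ => hsol.hasDerivAt s)
        (fun s _ => hsol.hasDerivAt_deriv h3 s) (fun s hs => (h6 s (hball s hs)).1) hs,
      norm_taylor_one_le (fun s _ => hsol.hasDerivAt_deriv h3 s)
        (fun s _ => hΩ.hasDerivAt_secondDeriv hsol h3 s) (fun s hs => (h6 s (hball s hs)).2) hs⟩
  refine ⟨fun t => (X t).1, fun t => (X t).2, ?_, ?_, ?_, ?_, ?_⟩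
  · refine tendsto_nhds_unique (hX d).norm (tendsto_const_nhds.congr' ?_)
    filter_upwards [hUp] with p hp using (hΨ p hp).2.symm
  · obtain ⟨C, -, hC⟩ := hbd (d - 1) (d + 1) ⟨by linarith, by linarith⟩
    refine ⟨C, fun t ht => le_of_tendsto ((hX t).sub (hX d)).norm ?_⟩
    filter_upwards [hC] with p hp using (hp t ht).2
  · intro t ht
    obtain ⟨r, hr, hrd, C, hC⟩ := htaylor t ht
    exact hasDerivAt_of_tendsto_of_taylor (F := Ψ) (G := fun p => deriv (Ψ p)) hr
      (fun s _ => hXψ s) (hXφ t ht) (hC.mono fun p hp s hs => (hp s hs).1)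
  · intro t ht
    obtain ⟨r, hr, hrd, C, hC⟩ := htaylor t ht
    exact hasDerivAt_of_tendsto_of_taylor (F := fun p => deriv (Ψ p))
      (G := fun p t => ((p.1 : ℂ) ^ 2 + coeffA Ω t / (Ω t - p.2)) * Ψ p t) hr
      (fun s hs => hXφ s (hrd s hs)) (hXχ t ht) (hC.mono fun p hp s hs => (hp s hs).2)
  · obtain ⟨T, hT, η, hη, htail⟩ := hΩ.exists_tail hα0 hα2 hμ₀ hμ₀'
    obtain ⟨N, hN0, hN⟩ := hbd (min d (-T)) (max d T) ⟨min_le_left _ _, le_max_left _ _⟩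
    -- The square root of `N ^ 2 * exp (-(|t| - T))`, which also bounds ψ for |t| ≤ T, where the
    -- exponential is at least 1.
    refine ⟨N * Real.exp (T / 2), fun t => ?_⟩
    have hsq : ‖(X t).1‖ ^ 2 ≤ N ^ 2 * Real.exp (-(|t| - T)) := by
      refine le_of_tendsto ((hXψ t).norm.pow 2) ?_
      filter_upwards [hUp, him, hμη η hη, hm34, hN] with p hp h1 h2 h3 h4
      have hψN : ∀ s ∈ Set.Icc (-T) T, ‖Ψ p s‖ ≤ N := fun s hs =>
        (norm_fst_le (state Ω p.2 (Ψ p) s)).trans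
          (h4 s ⟨(min_le_right _ _).trans hs.1, hs.2.trans (le_max_right _ _)⟩).1
      rcases le_total T |t| with ht | ht
      · exact (hΨ p hp).1.norm_sq_le_mul_exp h1 h3 (fun s hs => htail s hs p.2 h2)
          (hψN T ⟨by linarith, le_rfl⟩) (hψN (-T) ⟨le_rfl, by linarith⟩) ht
      · have h5 := pow_le_pow_left₀ (norm_nonneg _) (hψN t (abs_le.1 ht)) 2
        exact h5.trans (le_mul_of_one_le_right (by positivity)
          (Real.one_le_exp (by linarith)))
    refine le_of_sq_le_sq ?_ (by positivity)
    refine hsq.trans (le_of_eq ?_)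
    rw [mul_pow, mul_pow, mul_assoc, ← Real.exp_nat_mul, ← Real.exp_nat_mul, ← Real.exp_add]
    congr 2
    push_cast
    ring

/-! ### Analysis of the limiting solution -/

theorem nonpos_of_monotoneOn_of_tendsto {F : ℝ → ℝ} {s : Set ℝ} {l : Filter ℝ} [l.NeBot]
    (hF : MonotoneOn F s) (hl : Tendsto F l (𝓝 0)) {x : ℝ} (hx : x ∈ s)
    (h : ∀ᶠ y in l, y ∈ s ∧ x ≤ y) : F x ≤ 0 :=
  ge_of_tendsto hl (h.mono fun _ hy => hF hx hy.1 hy.2)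

theorem nonneg_of_monotoneOn_of_tendsto {F : ℝ → ℝ} {s : Set ℝ} {l : Filter ℝ} [l.NeBot]
    (hF : MonotoneOn F s) (hl : Tendsto F l (𝓝 0)) {x : ℝ} (hx : x ∈ s)
    (h : ∀ᶠ y in l, y ∈ s ∧ y ≤ x) : 0 ≤ F x :=
  le_of_tendsto hl (h.mono fun _ hy => hF hy.1 hx hy.2)

theorem monotoneOn_of_hasDerivAt_nonneg {F F' : ℝ → ℝ} {s : Set ℝ} (hs : Convex ℝ s)
    (hF : ∀ t ∈ s, HasDerivAt F (F' t) t) (h : ∀ t ∈ s, 0 ≤ F' t) : MonotoneOn F s :=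
  monotoneOn_of_hasDerivWithinAt_nonneg hs (fun t ht => (hF t ht).continuousAt.continuousWithinAt)
    (fun t ht => (hF t (interior_subset ht)).hasDerivWithinAt)
    fun t ht => h t (interior_subset ht)

theorem eq_zero_of_hasDerivAt_zero_Ioi {F : ℝ → ℝ} {d : ℝ} (hF : ∀ t > d, HasDerivAt F 0 t)
    (hl : Tendsto F atTop (𝓝 0)) {t : ℝ} (ht : d < t) : F t = 0 := by
  have h : ∀ᶠ y in atTop, y ∈ Set.Ioi d ∧ t ≤ y :=
    (eventually_gt_atTop d).and (eventually_ge_atTop t)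
  refine le_antisymm (nonpos_of_monotoneOn_of_tendsto (monotoneOn_of_hasDerivAt_nonneg
    (convex_Ioi d) hF fun _ _ => le_rfl) hl ht h) ?_
  have := nonpos_of_monotoneOn_of_tendsto (monotoneOn_of_hasDerivAt_nonneg
    (convex_Ioi d) (fun t ht => (hF t ht).neg) fun _ _ => by simp)
    (by have h1 := hl.neg; rw [neg_zero] at h1; exact h1) ht h
  simpa using this

theorem eq_zero_of_hasDerivAt_zero_Iio {F : ℝ → ℝ} {d : ℝ} (hF : ∀ t < d, HasDerivAt F 0 t)
    (hl : Tendsto F atBot (𝓝 0)) {t : ℝ} (ht : t < d) : F t = 0 := by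
  have := eq_zero_of_hasDerivAt_zero_Ioi (F := fun t => F (-t)) (d := -d)
    (fun s hs => ((hF (-s) (by linarith)).comp s (hasDerivAt_id s).neg).congr_deriv (by simp))
    (hl.comp tendsto_neg_atTop_atBot) (t := -t) (by linarith)
  simpa using this

/-- The derivative of a limiting mode off the singular point. -/
noncomputable def modeDeriv (Ω : ℝ → ℝ) (μ : ℝ) (ψ v : ℝ → ℂ) (t : ℝ) : ℂ :=
  v t + slopeRatio Ω t * logGap Ω μ t * ψ t

section Mode

variable {α : ℝ} {Ω : ℝ → ℝ} {Ωinf a b : ℝ} {m μ d : ℝ} {ψ v : ℝ → ℂ}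

theorem IsLimitMode.continuousAt_prod (h : IsLimitMode Ω m μ d ψ v) :
    ContinuousAt (fun t => (ψ t, v t)) d := by
  obtain ⟨C, hC⟩ := h.holder
  rw [ContinuousAt, tendsto_iff_norm_sub_tendsto_zero]
  have h1 : Tendsto (fun t => C * √|t - d|) (𝓝 d) (𝓝 0) := by
    have : Continuous fun t => C * √|t - d| := by fun_prop
    simpa using this.tendsto d
  refine squeeze_zero' (Eventually.of_forall fun _ => norm_nonneg _) ?_ h1
  filter_upwards [Icc_mem_nhds (show d - 1 < d by linarith) (show d < d + 1 by linarith)] with t ht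
    using hC t ht

theorem IsLimitMode.continuousAt_fst (h : IsLimitMode Ω m μ d ψ v) : ContinuousAt ψ d :=
  h.continuousAt_prod.fst

theorem IsLimitMode.continuousAt_snd (h : IsLimitMode Ω m μ d ψ v) : ContinuousAt v d :=
  h.continuousAt_prod.snd

theorem IsLimitMode.continuous (h : IsLimitMode Ω m μ d ψ v) : Continuous ψ := by
  refine continuous_iff_continuousAt.2 fun t => ?_
  rcases eq_or_ne t d with rfl | ht
  · exact h.continuousAt_fst
  · exact (h.hasDerivAt t ht).continuousAt

theorem tendsto_decay {l : Filter ℝ} (hl : Tendsto (fun t : ℝ => |t|) l atTop) (C : ℝ) :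
    Tendsto (fun t => C * Real.exp (-(1 / 2) * |t|)) l (𝓝 0) := by
  have := ((tendsto_exp_mul_atTop (c := -(1 / 2)) (by norm_num)).comp hl).const_mul C
  rwa [mul_zero] at this

theorem IsLimitMode.tendsto_zero (h : IsLimitMode Ω m μ d ψ v) {l : Filter ℝ}
    (hl : Tendsto (fun t : ℝ => |t|) l atTop) : Tendsto ψ l (𝓝 0) := by
  obtain ⟨C, hC⟩ := h.decay
  exact squeeze_zero_norm hC (tendsto_decay hl C)

/-- Bounds on ψ and ψ'' bound ψ' through the Taylor formula between t and t + 1. The margin 2 keeps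
the ball of radius 2 in the tail and away from `d`. -/
theorem IsLimitMode.exists_modeDeriv_bound (h : IsLimitMode Ω m μ d ψ v)
    {T : ℝ} (htail : ∀ t, T ≤ |t| → ‖(coeffA Ω t : ℂ) / (Ω t - μ)‖ ≤ 1 / 4) :
    ∃ B, ∀ t, max T |d| + 2 ≤ |t| → ‖modeDeriv Ω μ ψ v t‖ ≤ B := by
  obtain ⟨C, hC⟩ := h.decay
  have hC0 : 0 ≤ C := by
    have := (norm_nonneg _).trans (hC 0)
    simpa using this
  have hψ : ∀ t, ‖ψ t‖ ≤ C := fun t => (hC t).trans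
    (mul_le_of_le_one_right hC0 (Real.exp_le_one_iff.2 (by linarith [abs_nonneg t])))
  refine ⟨C + C + (m ^ 2 + 1 / 4) * C, fun t ht => ?_⟩
  have hball : ∀ s ∈ Metric.ball t 2, T ≤ |s| ∧ s ≠ d := by
    intro s hs
    rw [Metric.mem_ball, Real.dist_eq] at hs
    have h1 := abs_sub_abs_le_abs_sub t s
    rw [abs_sub_comm] at h1
    refine ⟨by linarith [le_max_left T |d|], ?_⟩
    rintro rfl
    linarith [le_max_right T |s|]
  have h1 := norm_taylor_one_le (F := ψ) (G := modeDeriv Ω μ ψ v)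
    (H := fun t => ((m : ℂ) ^ 2 + coeffA Ω t / (Ω t - μ)) * ψ t) (t := t) (r := 2)
    (C := (m ^ 2 + 1 / 4) * C)
    (fun s hs => h.hasDerivAt s (hball s hs).2) (fun s hs => h.hasDerivAt_deriv s (hball s hs).2)
    (fun s hs => by
      rw [norm_mul]
      refine mul_le_mul ((norm_add_le _ _).trans (add_le_add ?_ (htail s (hball s hs).1))) (hψ s)
        (norm_nonneg _) (by positivity)
      rw [norm_pow, Complex.norm_real, Real.norm_eq_abs, sq_abs])
    (s := t + 1) (by simp)
  simp only [add_sub_cancel_left, abs_one, one_smul, mul_one] at h1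
  have h2 : modeDeriv Ω μ ψ v t = ψ (t + 1) - ψ t - (ψ (t + 1) - ψ t - modeDeriv Ω μ ψ v t) := by
    ring
  rw [h2]
  exact (norm_sub_le _ _).trans
    (add_le_add ((norm_sub_le _ _).trans (add_le_add (hψ _) (hψ _))) h1)

theorem IsLimitMode.tendsto_conj_mul_modeDeriv (h : IsLimitMode Ω m μ d ψ v)
    {T : ℝ} (htail : ∀ t, T ≤ |t| → ‖(coeffA Ω t : ℂ) / (Ω t - μ)‖ ≤ 1 / 4) {l : Filter ℝ}
    (hl : Tendsto (fun t : ℝ => |t|) l atTop) :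
    Tendsto (fun t => star (ψ t) * modeDeriv Ω μ ψ v t) l (𝓝 0) := by
  obtain ⟨B, hB⟩ := h.exists_modeDeriv_bound htail
  have h1 : Tendsto (fun t => ‖ψ t‖ * B) l (𝓝 0) := by
    simpa using (h.tendsto_zero hl).norm.mul_const B
  refine squeeze_zero_norm' ?_ h1
  filter_upwards [hl.eventually_ge_atTop (max T |d| + 2)] with t ht
  rw [norm_mul, norm_star]
  exact mul_le_mul_of_nonneg_left (hB t ht) (norm_nonneg _)

/-- For real μ the potential is real, so this derivative is real: the imaginary part is a conserved
flux on each side of `d`. -/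
theorem IsLimitMode.hasDerivAt_conj_mul_modeDeriv (h : IsLimitMode Ω m μ d ψ v) {t : ℝ}
    (ht : t ≠ d) : HasDerivAt (fun t => star (ψ t) * modeDeriv Ω μ ψ v t)
      ((‖modeDeriv Ω μ ψ v t‖ ^ 2 + (m ^ 2 + coeffA Ω t / (Ω t - μ)) * ‖ψ t‖ ^ 2 : ℝ) : ℂ) t := by
  refine ((h.hasDerivAt t ht).star.mul (h.hasDerivAt_deriv t ht)).congr_deriv ?_
  change star (modeDeriv Ω μ ψ v t) * modeDeriv Ω μ ψ v t + star (ψ t) * (_ * ψ t) = _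
  have h1 : ∀ z : ℂ, star z * z = ((‖z‖ ^ 2 : ℝ) : ℂ) := fun z => by
    rw [Complex.sq_norm, Complex.normSq_eq_conj_mul_self]; rfl
  rw [mul_left_comm, h1, h1]
  push_cast
  ring

theorem conj_mul_modeDeriv (t : ℝ) : star (ψ t) * modeDeriv Ω μ ψ v t =
    star (ψ t) * v t + ((slopeRatio Ω t * ‖ψ t‖ ^ 2 : ℝ) : ℂ) * logGap Ω μ t := by
  have h1 : star (ψ t) * ψ t = ((‖ψ t‖ ^ 2 : ℝ) : ℂ) := by
    rw [Complex.sq_norm, Complex.normSq_eq_conj_mul_self]; rfl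
  rw [modeDeriv, Complex.ofReal_mul, ← h1]
  ring

theorem logGap_im_of_lt (h : Ω d < μ) : (logGap Ω μ d).im = 0 := by
  rw [logGap, Complex.log_im, ← Complex.ofReal_sub, Complex.arg_ofReal_of_nonneg (by linarith)]

theorem logGap_im_of_gt (h : μ < Ω d) : (logGap Ω μ d).im = Real.pi := by
  rw [logGap, Complex.log_im, ← Complex.ofReal_sub, Complex.arg_ofReal_of_neg (by linarith)]

/-- The flux `Im (ψ̄ ψ')` vanishes, and its jump across `d` is `π (A / Ω') |ψ|²`. -/
theorem IsLimitMode.slopeRatio_mul_eq_zero (hΩ : IsClassC α Ω Ωinf a b)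
    (h : IsLimitMode Ω m μ d ψ v) (hd : Ω d = μ) {T : ℝ}
    (htail : ∀ t, T ≤ |t| → ‖(coeffA Ω t : ℂ) / (Ω t - μ)‖ ≤ 1 / 4) :
    slopeRatio Ω d = 0 ∨ ψ d = 0 := by
  set J : ℝ → ℝ := fun t => (star (ψ t) * modeDeriv Ω μ ψ v t).im with hJ
  have hJ' : ∀ t ≠ d, HasDerivAt J 0 t := by
    intro t ht
    have := Complex.imCLM.hasFDerivAt.comp_hasDerivAt t (h.hasDerivAt_conj_mul_modeDeriv ht)
    exact this.congr_deriv (by simp only [Complex.imCLM_apply, Complex.ofReal_im])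
  have hJl : ∀ {l : Filter ℝ}, Tendsto (fun t : ℝ => |t|) l atTop → Tendsto J l (𝓝 0) := by
    intro l hl
    exact (Complex.continuous_im.tendsto 0).comp (h.tendsto_conj_mul_modeDeriv htail hl)
  have hJr : ∀ t > d, J t = 0 := fun t ht => eq_zero_of_hasDerivAt_zero_Ioi
    (fun t ht => hJ' t (ne_of_gt ht)) (hJl tendsto_abs_atTop_atTop) ht
  have hJle : ∀ t < d, J t = 0 := fun t ht => eq_zero_of_hasDerivAt_zero_Iio
    (fun t ht => hJ' t (ne_of_lt ht)) (hJl tendsto_abs_atBot_atTop) ht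
  have hJeq : ∀ t, J t = (star (ψ t) * v t).im + slopeRatio Ω t * ‖ψ t‖ ^ 2 *
      (logGap Ω μ t).im := by
    intro t
    simp only [hJ]
    rw [conj_mul_modeDeriv, Complex.add_im, Complex.im_ofReal_mul]
  have hc1 : ContinuousAt (fun t => (star (ψ t) * v t).im) d :=
    Complex.continuous_im.continuousAt.comp (h.continuousAt_fst.star.mul h.continuousAt_snd)
  have hc2 : ContinuousAt (fun t => slopeRatio Ω t * ‖ψ t‖ ^ 2 * Real.pi) d :=
    ((hΩ.hasDerivAt_slopeRatio d).continuousAt.mul (h.continuousAt_fst.norm.pow 2)).mul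
      continuousAt_const
  -- Limit from the right, where μ - Ω > 0 and the logarithm is real.
  have h1 : (star (ψ d) * v d).im = 0 := by
    refine tendsto_nhds_unique (hc1.tendsto.mono_left nhdsWithin_le_nhds)
      ((tendsto_const_nhds (x := (0 : ℝ)) (f := 𝓝[>] d)).congr' ?_)
    filter_upwards [self_mem_nhdsWithin] with t ht
    have h2 := hJeq t
    rw [hJr t ht, logGap_im_of_lt (hd ▸ hΩ.strictAnti ht), mul_zero, add_zero] at h2
    exact h2
  -- Limit from the left, where μ - Ω < 0 and the logarithm contributes π.
  have h2 : (star (ψ d) * v d).im + slopeRatio Ω d * ‖ψ d‖ ^ 2 * Real.pi = 0 := by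
    refine tendsto_nhds_unique ((hc1.add hc2).tendsto.mono_left nhdsWithin_le_nhds)
      ((tendsto_const_nhds (x := (0 : ℝ)) (f := 𝓝[<] d)).congr' ?_)
    filter_upwards [self_mem_nhdsWithin] with t ht
    have h2 := hJeq t
    rwa [hJle t ht, logGap_im_of_gt (hd ▸ hΩ.strictAnti ht)] at h2
  rw [h1, zero_add] at h2
  have h3 : slopeRatio Ω d * ‖ψ d‖ ^ 2 = 0 := (mul_eq_zero.1 h2).resolve_right Real.pi_ne_zero
  rcases mul_eq_zero.1 h3 with h4 | h4
  · exact Or.inl h4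
  · exact Or.inr (norm_eq_zero.1 (pow_eq_zero_iff two_ne_zero |>.1 h4))

/-- Both factors are Hölder of exponent 1/2 at `d` and their product vanishes there; this rate beats
the logarithm. -/
theorem IsLimitMode.exists_slopeRatio_mul_le (hΩ : IsClassC α Ω Ωinf a b)
    (h : IsLimitMode Ω m μ d ψ v) (h0 : slopeRatio Ω d = 0 ∨ ψ d = 0) :
    ∃ C, ∀ᶠ t in 𝓝 d, ‖(slopeRatio Ω t : ℂ) * ψ t‖ ≤ C * √|t - d| := by
  obtain ⟨C, hC⟩ := h.holder
  have h1 : (fun t => (slopeRatio Ω t : ℂ)) =O[𝓝 d] fun _ => (1 : ℝ) :=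
    (hΩ.hasDerivAt_slopeRatio d).ofReal_comp.continuousAt.isBigO_one ℝ
  have h2 : (fun t => ψ t - ψ d) =O[𝓝 d] fun t => √|t - d| := by
    refine Asymptotics.IsBigO.of_bound C ?_
    filter_upwards [Icc_mem_nhds (show d - 1 < d by linarith) (show d < d + 1 by linarith)]
      with t ht
    rw [Real.norm_of_nonneg (Real.sqrt_nonneg _)]
    exact (norm_fst_le ((ψ t, v t) - (ψ d, v d))).trans (hC t ht)
  have h3 : (fun t => (slopeRatio Ω t : ℂ) - slopeRatio Ω d) =O[𝓝 d] fun t => √|t - d| := by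
    refine (hΩ.hasDerivAt_slopeRatio d).ofReal_comp.isBigO_sub.trans
      (Asymptotics.IsBigO.of_bound 1 ?_)
    filter_upwards [Icc_mem_nhds (show d - 1 < d by linarith) (show d < d + 1 by linarith)]
      with t ht
    have h4 : |t - d| ≤ 1 := abs_le.2 ⟨by linarith [ht.1], by linarith [ht.2]⟩
    rw [one_mul, Real.norm_of_nonneg (Real.sqrt_nonneg _), Real.norm_eq_abs]
    exact Real.le_sqrt_of_sq_le (by nlinarith [abs_nonneg (t - d)])
  have h5 : (fun t => (slopeRatio Ω t : ℂ) * ψ t) =O[𝓝 d] fun t => √|t - d| := by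
    have h6 := h1.mul h2
    have h7 := h3.mul (Asymptotics.isBigO_const_const (ψ d) (one_ne_zero (α := ℝ)) (𝓝 d))
    simp only [one_mul, mul_one] at h6 h7
    refine (h6.add h7).congr_left fun t => ?_
    have h7 : (slopeRatio Ω d : ℂ) * ψ d = 0 := by
      rcases h0 with h0 | h0 <;> simp [h0]
    linear_combination -h7
  obtain ⟨C', hC'⟩ := h5.bound
  refine ⟨C', hC'.mono fun t ht => ?_⟩
  rwa [Real.norm_of_nonneg (Real.sqrt_nonneg _)] at ht

/-- As Ω'(d) ≠ 0, |t - d| is at most a multiple of |Ω - μ|, so log² √|t - d| is bounded. The square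
of the logarithmic term is then O(√|t - d|). -/
theorem IsLimitMode.continuousAt_modeDeriv (hΩ : IsClassC α Ω Ωinf a b)
    (h : IsLimitMode Ω m μ d ψ v) (hd : Ω d = μ) (h0 : slopeRatio Ω d = 0 ∨ ψ d = 0) :
    ContinuousAt (modeDeriv Ω μ ψ v) d := by
  refine h.continuousAt_snd.add ?_
  have hLd : logGap Ω μ d = 0 := by simp [logGap, hd]
  obtain ⟨C, hC⟩ := h.exists_slopeRatio_mul_le hΩ h0
  obtain ⟨Cl, hCl, hl⟩ := exists_norm_log_sq_mul_sqrt_le 1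
  obtain ⟨D, hD0, hD⟩ : ∃ D > 0, ∀ᶠ t in 𝓝 d, |t - d| ≤ D * |Ω t - Ω d| := by
    obtain ⟨D, hD0, hD⟩ := ((hΩ.hasDerivAt d).isTheta_sub
      (hΩ.deriv_neg d).ne).isBigO_symm.exists_pos
    exact ⟨D, hD0, by simpa [Filter.prod_pure] using hD.bound⟩
  have hsm : ∀ᶠ t in 𝓝 d, |Ω t - Ω d| ≤ 1 := by
    have := (hΩ.hasDerivAt d).continuousAt.eventually (Metric.closedBall_mem_nhds (Ω d) one_pos)
    filter_upwards [this] with t ht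
    rwa [← Real.dist_eq]
  have hlim : Tendsto (fun t => √(C ^ 2 * (Cl * √D) * √|t - d|)) (𝓝 d) (𝓝 0) := by
    have : Continuous fun t => √(C ^ 2 * (Cl * √D) * √|t - d|) := by fun_prop
    simpa using this.tendsto d
  rw [ContinuousAt, hLd, mul_zero, zero_mul]
  refine squeeze_zero_norm' ?_ hlim
  filter_upwards [hC, hD, hsm] with t h1 h2 h3
  rcases eq_or_ne t d with rfl | ht
  · simp [hLd]
  have hz : ‖(μ : ℂ) - Ω t‖ = |Ω t - Ω d| := by
    rw [← hd, ← Complex.ofReal_sub, Complex.norm_real, Real.norm_eq_abs, abs_sub_comm]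
  have ht0 : 0 < |t - d| := abs_pos.2 (sub_ne_zero.2 ht)
  have hz0 : (μ : ℂ) - Ω t ≠ 0 := by
    rw [← norm_pos_iff, hz]
    exact pos_of_mul_pos_right (ht0.trans_le h2) hD0.le
  have h4 := hl _ hz0 (by rw [hz]; exact h3)
  have h5 : ‖logGap Ω μ t‖ ^ 2 * √|t - d| ≤ Cl * √D := by
    have h6 : √|t - d| ≤ √D * √‖(μ : ℂ) - Ω t‖ := by
      rw [hz, ← Real.sqrt_mul hD0.le]; exact Real.sqrt_le_sqrt h2
    have h7 : ‖logGap Ω μ t‖ ^ 2 * √‖(μ : ℂ) - Ω t‖ ≤ Cl := by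
      refine le_trans ?_ h4
      exact mul_le_mul_of_nonneg_right (by rw [logGap]; linarith) (Real.sqrt_nonneg _)
    calc _ ≤ ‖logGap Ω μ t‖ ^ 2 * (√D * √‖(μ : ℂ) - Ω t‖) :=
          mul_le_mul_of_nonneg_left h6 (by positivity)
      _ = (‖logGap Ω μ t‖ ^ 2 * √‖(μ : ℂ) - Ω t‖) * √D := by ring
      _ ≤ _ := mul_le_mul_of_nonneg_right h7 (Real.sqrt_nonneg _)
  refine Real.le_sqrt_of_sq_le ?_
  rw [mul_right_comm, norm_mul, mul_pow]
  have h6 := pow_le_pow_left₀ (norm_nonneg _) h1 2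
  rw [mul_pow] at h6
  calc _ ≤ C ^ 2 * √|t - d| ^ 2 * ‖logGap Ω μ t‖ ^ 2 :=
        mul_le_mul_of_nonneg_right h6 (by positivity)
    _ = C ^ 2 * (‖logGap Ω μ t‖ ^ 2 * √|t - d|) * √|t - d| := by ring
    _ ≤ _ := mul_le_mul_of_nonneg_right (mul_le_mul_of_nonneg_left h5 (by positivity))
        (Real.sqrt_nonneg _)

theorem IsLimitMode.hasDerivAt_modeDeriv (hΩ : IsClassC α Ω Ωinf a b)
    (h : IsLimitMode Ω m μ d ψ v) (hd : Ω d = μ) (h0 : slopeRatio Ω d = 0 ∨ ψ d = 0) (t : ℝ) :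
    HasDerivAt ψ (modeDeriv Ω μ ψ v t) t :=
  hasDerivAt_of_hasDerivAt_of_ne' h.hasDerivAt h.continuousAt_fst
    (h.continuousAt_modeDeriv hΩ hd h0) t

/-! ### Non-vanishing of the limiting mode at the singular point -/

theorem modeDeriv_self (hd : Ω d = μ) : modeDeriv Ω μ ψ v d = v d := by
  simp [modeDeriv, logGap, hd]

/-- The logarithmic derivative of `e ^ t (Ω - μ)`, a solution of the equation with wave number
`1`. -/
noncomputable def riccati (Ω : ℝ → ℝ) (μ t : ℝ) : ℝ := 1 + deriv Ω t / (Ω t - μ)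

/-- For f = e^t(Ω - μ), f'' = e^t(Ω - μ + A) = (1 + A/(Ω - μ)) f; this is the Riccati equation of
f'/f. -/
theorem IsClassC.hasDerivAt_riccati (hΩ : IsClassC α Ω Ωinf a b) {t : ℝ} (ht : Ω t ≠ μ) :
    HasDerivAt (riccati Ω μ) (1 + coeffA Ω t / (Ω t - μ) - riccati Ω μ t ^ 2) t := by
  have h0 : Ω t - μ ≠ 0 := sub_ne_zero.2 ht
  refine (((hΩ.hasDerivAt_deriv t).div ((hΩ.hasDerivAt t).sub_const μ) h0).const_add
    1).congr_deriv ?_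
  rw [riccati, coeffA]
  field_simp
  ring

/-- A limiting mode cannot vanish at the singular point: comparison with `e ^ t (Ω - μ)` on the
right of it. -/
theorem IsLimitMode.ne_zero_at (hΩ : IsClassC α Ω Ωinf a b) (hα0 : 0 < α) (hα2 : α < 2)
    (h : IsLimitMode Ω m μ d ψ v) (hm : 1 ≤ m) (hμ : 0 < μ) (hd : Ω d = μ) {T : ℝ}
    (htail : ∀ t, T ≤ |t| → ‖(coeffA Ω t : ℂ) / (Ω t - μ)‖ ≤ 1 / 4) : ψ d ≠ 0 := by
  intro hψd
  obtain ⟨hΩ0, hΩ1, -⟩ := hΩ.tendsto_atTop hα0 hα2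
  have hder := h.hasDerivAt_modeDeriv hΩ hd (Or.inr hψd)
  have hcont := h.continuousAt_modeDeriv hΩ hd (Or.inr hψd)
  have hlt : ∀ t > d, Ω t < μ := fun t ht => hd ▸ hΩ.strictAnti ht
  set φ := modeDeriv Ω μ ψ v with hφ
  set ρ := riccati Ω μ with hρ
  -- Picone's identity: by the Riccati equation the potentials cancel in G', leaving (m² - 1)|ψ|²
  -- and a square.
  set G : ℝ → ℝ := fun t => (star (ψ t) * φ t).re - ‖ψ t‖ ^ 2 * ρ t with hG
  set G' : ℝ → ℝ := fun t => (m ^ 2 - 1) * ‖ψ t‖ ^ 2 + ‖φ t - ρ t * ψ t‖ ^ 2 with hG'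
  have hGd : ∀ t > d, HasDerivAt G (G' t) t := by
    intro t ht
    have h1 := Complex.reCLM.hasFDerivAt.comp_hasDerivAt t
      (h.hasDerivAt_conj_mul_modeDeriv (ne_of_gt ht))
    refine (h1.sub ((hder t).norm_sq.mul (hΩ.hasDerivAt_riccati (hlt t ht).ne))).congr_deriv ?_
    simp only [hG', Complex.reCLM_apply, Complex.ofReal_re, Complex.inner, Complex.sq_norm,
      Complex.normSq_apply, Complex.sub_re, Complex.sub_im, Complex.mul_re, Complex.mul_im,
      Complex.ofReal_im, Complex.conj_re, Complex.conj_im]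
    ring
  have hG'0 : ∀ t, 0 ≤ G' t := fun t =>
    add_nonneg (mul_nonneg (by nlinarith) (sq_nonneg _)) (sq_nonneg _)
  have hmono : MonotoneOn G (Set.Ioi d) :=
    monotoneOn_of_hasDerivAt_nonneg (convex_Ioi d) hGd fun t _ => hG'0 t
  have hre : ∀ {l : Filter ℝ}, Tendsto (fun t => star (ψ t) * φ t) l (𝓝 0) →
      Tendsto (fun t => (star (ψ t) * φ t).re) l (𝓝 0) := fun hl =>
    (Complex.continuous_re.tendsto 0).comp hl
  have hψtop := h.tendsto_zero tendsto_abs_atTop_atTop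
  have hGtop : Tendsto G atTop (𝓝 0) := by
    have h1 := hre (h.tendsto_conj_mul_modeDeriv htail tendsto_abs_atTop_atTop)
    have h2 : Tendsto ρ atTop (𝓝 (1 + 0 / (0 - μ))) :=
      (hΩ1.div (hΩ0.sub_const μ) (by linarith)).const_add 1
    have h3 := h1.sub ((hψtop.norm.pow 2).mul h2)
    rw [norm_zero, zero_pow two_ne_zero, zero_mul, sub_zero] at h3
    exact h3
  have hGnhds : Tendsto G (𝓝[>] d) (𝓝 0) := by
    have hψ0 : Tendsto ψ (𝓝[>] d) (𝓝 0) := by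
      have := h.continuousAt_fst.tendsto.mono_left (nhdsWithin_le_nhds (s := Set.Ioi d))
      rwa [hψd] at this
    have hφ0 : Tendsto φ (𝓝[>] d) (𝓝 (φ d)) := hcont.tendsto.mono_left nhdsWithin_le_nhds
    have h1 : Tendsto (fun t => star (ψ t) * φ t) (𝓝[>] d) (𝓝 0) := by
      simpa using hψ0.star.mul hφ0
    have hle : 𝓝[>] d ≤ 𝓝[≠] d := nhdsWithin_mono d fun t ht => ne_of_gt ht
    have hs1 : Tendsto (slope ψ d) (𝓝[>] d) (𝓝 (φ d)) := (hder d).tendsto_slope.mono_left hle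
    have hs2 : Tendsto (slope Ω d) (𝓝[>] d) (𝓝 (deriv Ω d)) :=
      (hΩ.hasDerivAt d).tendsto_slope.mono_left hle
    have hd1 : Tendsto (deriv Ω) (𝓝[>] d) (𝓝 (deriv Ω d)) :=
      hΩ.contDiff_deriv.continuous.continuousAt.tendsto.mono_left nhdsWithin_le_nhds
    -- This is |ψ|²ρ with its pole at `d` resolved: Ω'/(Ω - μ) is of order 1/(t - d), and one factor
    -- |ψ| divided by t - d stays bounded as ψ(d) = 0.
    have h2 : Tendsto (fun t => ‖ψ t‖ ^ 2 + ‖ψ t‖ * ‖slope ψ d t‖ * (deriv Ω t * |slope Ω d t|⁻¹ *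
        -1)) (𝓝[>] d) (𝓝 0) := by
      have h3 := (hψ0.norm.pow 2).add ((hψ0.norm.mul hs1.norm).mul
        ((hd1.mul (hs2.abs.inv₀ (abs_pos.2 (hΩ.deriv_neg d).ne).ne')).mul_const (-1)))
      simpa using h3
    have h4 := (hre h1).sub h2
    rw [sub_zero] at h4
    refine h4.congr' ?_
    filter_upwards [self_mem_nhdsWithin] with t ht
    have ht0 : 0 < t - d := sub_pos.2 ht
    have hg : Ω t - μ < 0 := sub_neg.2 (hlt t ht)
    have e1 : ‖slope ψ d t‖ = ‖ψ t‖ / (t - d) := by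
      rw [slope_def_module, hψd, sub_zero, norm_smul, norm_inv, Real.norm_of_nonneg ht0.le,
        div_eq_inv_mul]
    have e2 : |slope Ω d t| = -(Ω t - μ) / (t - d) := by
      rw [slope_def_field, hd, abs_div, abs_of_neg hg, abs_of_pos ht0]
    simp only [hG, hρ, riccati]
    rw [e1, e2]
    have hg' := hg.ne
    have ht' := ht0.ne'
    have hg'' : -(Ω t - μ) ≠ 0 := neg_ne_zero.2 hg'
    congr 1
    rw [inv_div, div_neg]
    field_simp
  -- A monotone function with limit 0 at both ends vanishes; then G' = 0, and its square term gives
  -- φ = ρψ even when m = 1.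
  have hG0 : ∀ t > d, G t = 0 := fun t ht => le_antisymm
    (nonpos_of_monotoneOn_of_tendsto hmono hGtop ht
      ((eventually_gt_atTop d).and (eventually_ge_atTop t)))
    (nonneg_of_monotoneOn_of_tendsto hmono hGnhds ht (by
      filter_upwards [self_mem_nhdsWithin, Ioc_mem_nhdsGT ht] with y hy hy' using ⟨hy, hy'.2⟩))
  have hφρ : ∀ t > d, φ t = ρ t * ψ t := by
    intro t ht
    have h1 : HasDerivAt G 0 t := by
      refine (hasDerivAt_const t (0 : ℝ)).congr_of_eventuallyEq ?_
      filter_upwards [Ioi_mem_nhds ht] with s hs using hG0 s hs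
    have h2 : G' t = 0 := (hGd t ht).unique h1
    have h3 : ‖φ t - ρ t * ψ t‖ ^ 2 ≤ 0 := by
      have h4 : 0 ≤ (m ^ 2 - 1) * ‖ψ t‖ ^ 2 := mul_nonneg (by nlinarith) (sq_nonneg _)
      simp only [hG'] at h2
      linarith
    exact sub_eq_zero.1 (norm_eq_zero.1 (pow_eq_zero_iff two_ne_zero |>.1
      (le_antisymm h3 (sq_nonneg _))))
  -- The quotient of ψ by e^t(Ω - μ) is constant, and it tends to 0 at +∞ because Ω - μ → -μ ≠ 0
  -- there.
  have hψ0 : ∀ t > d, ψ t = 0 := by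
    have hk : ∀ t > d, HasDerivAt (fun t => ((Real.exp (-1 * t) / (Ω t - μ) : ℝ) : ℂ) * ψ t) 0 t := by
      intro t ht
      have hne : Ω t - μ ≠ 0 := (sub_neg.2 (hlt t ht)).ne
      have h1 := (((hasDerivAt_exp_mul (-1) t).div ((hΩ.hasDerivAt t).sub_const μ)
        hne).ofReal_comp.mul (hder t))
      refine h1.congr_deriv ?_
      change _ + ((Real.exp (-1 * t) / (Ω t - μ) : ℝ) : ℂ) * φ t = _
      rw [hφρ t ht, hρ, riccati]
      have hne' : (Ω t : ℂ) - μ ≠ 0 := by exact_mod_cast hne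
      push_cast
      field_simp
      ring
    have hlim : Tendsto (fun t => ((Real.exp (-1 * t) / (Ω t - μ) : ℝ) : ℂ) * ψ t) atTop (𝓝 0) := by
      have h1 : Tendsto (fun t => Real.exp (-1 * t) / (Ω t - μ)) atTop (𝓝 (0 / (0 - μ))) :=
        (tendsto_exp_mul_atTop (c := -1) (by norm_num)).div (hΩ0.sub_const μ) (by linarith)
      have h2 := ((Complex.continuous_ofReal.tendsto _).comp h1).mul hψtop
      simpa using h2
    intro t ht
    have hre0 := eq_zero_of_hasDerivAt_zero_Ioi
      (fun s hs => (Complex.reCLM.hasFDerivAt.comp_hasDerivAt s (hk s hs)).congr_deriv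
        (map_zero _)) ((Complex.continuous_re.tendsto 0).comp hlim) ht
    have him0 := eq_zero_of_hasDerivAt_zero_Ioi
      (fun s hs => (Complex.imCLM.hasFDerivAt.comp_hasDerivAt s (hk s hs)).congr_deriv
        (map_zero _)) ((Complex.continuous_im.tendsto 0).comp hlim) ht
    have h3 : ((Real.exp (-1 * t) / (Ω t - μ) : ℝ) : ℂ) * ψ t = 0 := Complex.ext hre0 him0
    refine (mul_eq_zero.1 h3).resolve_left ?_
    exact_mod_cast div_ne_zero (Real.exp_pos _).ne' (sub_neg.2 (hlt t ht)).ne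
  have hvd : v d = 0 := by
    rw [← modeDeriv_self (ψ := ψ) (v := v) hd]
    refine tendsto_nhds_unique (hcont.tendsto.mono_left (nhdsWithin_le_nhds (s := Set.Ioi d)))
      ((tendsto_const_nhds (x := (0 : ℂ))).congr' ?_)
    filter_upwards [self_mem_nhdsWithin] with t ht
    rw [hφρ t ht, hψ0 t ht, mul_zero]
  have := h.norm_eq_one
  simp [hψd, hvd] at this

/-! ### The limiting mode as a C² solution in L² -/

theorem memLp_two_of_norm_le_exp {ψ : ℝ → ℂ} (hψ : Continuous ψ) {C : ℝ}
    (hC : ∀ t, ‖ψ t‖ ≤ C * Real.exp (-(1 / 2) * |t|)) : MemLp ψ 2 := by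
  rw [memLp_two_iff_integrable_sq_norm hψ.aestronglyMeasurable]
  -- The factor 2 comes from 1 + t² ≤ 2 e^{|t|}.
  refine Integrable.mono' (integrable_inv_one_add_sq.const_mul (C ^ 2 * 2))
    (hψ.norm.pow 2).aestronglyMeasurable (Eventually.of_forall fun t => ?_)
  rw [Real.norm_of_nonneg (sq_nonneg _)]
  refine (pow_le_pow_left₀ (norm_nonneg _) (hC t) 2).trans ?_
  rw [mul_pow, mul_assoc]
  refine mul_le_mul_of_nonneg_left ?_ (sq_nonneg C)
  have h1 := Real.quadratic_le_exp_of_nonneg (abs_nonneg t)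
  rw [sq_abs] at h1
  have h2 : Real.exp (-(1 / 2) * |t|) ^ 2 = (Real.exp |t|)⁻¹ := by
    rw [← Real.exp_nat_mul, ← Real.exp_neg]
    congr 1
    push_cast
    ring
  rw [h2, ← div_eq_mul_inv, inv_eq_one_div, div_le_div_iff₀ (Real.exp_pos _) (by positivity)]
  linarith [abs_nonneg t]

theorem IsLimitMode.isL2Solution (hΩ : IsClassC α Ω Ωinf a b) (h : IsLimitMode Ω m μ d ψ v)
    (hd : Ω d = μ) (hA : coeffA Ω d = 0) : IsL2Solution Ω m μ ψ := by
  have h0 : slopeRatio Ω d = 0 ∨ ψ d = 0 := Or.inl (by rw [slopeRatio, hA, zero_div])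
  have hne : ∀ t ≠ d, Ω t ≠ μ := fun t ht e => ht (hΩ.strictAnti.injective (e.trans hd.symm))
  have hder := h.hasDerivAt_modeDeriv hΩ hd h0
  -- At `d` both A and Ω - μ vanish, so the quotient extends continuously by the ratio of
  -- derivatives. With a continuous potential the equation for ψ'' extends across `d`.
  set q : ℝ → ℝ := Function.update (fun t => coeffA Ω t / (Ω t - μ)) d
    (deriv (coeffA Ω) d / deriv Ω d) with hq
  have hqe : ∀ t ≠ d, q t = coeffA Ω t / (Ω t - μ) := fun t ht => by
    rw [hq, Function.update_of_ne ht]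
  have hqc : Continuous q := by
    refine continuous_iff_continuousAt.2 fun t => ?_
    rcases eq_or_ne t d with rfl | ht
    · rw [hq, continuousAt_update_same]
      refine ((hΩ.hasDerivAt_coeffA t).tendsto_slope.div (hΩ.hasDerivAt t).tendsto_slope
        (hΩ.deriv_neg t).ne).congr' ?_
      filter_upwards [self_mem_nhdsWithin] with s hs
      have hs' : s - t ≠ 0 := sub_ne_zero.2 hs
      simp only [Pi.div_apply, slope_def_field, hA, hd, sub_zero]
      rw [div_div_div_cancel_right₀ hs']
    · rw [hq, continuousAt_update_of_ne ht]
      exact (hΩ.hasDerivAt_coeffA t).continuousAt.div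
        ((hΩ.hasDerivAt t).continuousAt.sub continuousAt_const) (sub_ne_zero.2 (hne t ht))
  have hder2 : ∀ t, HasDerivAt (modeDeriv Ω μ ψ v) (((m : ℂ) ^ 2 + q t) * ψ t) t := by
    refine hasDerivAt_of_hasDerivAt_of_ne' (fun t ht => ?_) (h.continuousAt_modeDeriv hΩ hd h0) ?_
    · refine (h.hasDerivAt_deriv t ht).congr_deriv ?_
      rw [hqe t ht]
      push_cast
      rfl
    · exact ((continuous_const.add (Complex.continuous_ofReal.comp hqc)).mul
        h.continuous).continuousAt
  have e1 : deriv ψ = modeDeriv Ω μ ψ v := funext fun t => (hder t).deriv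
  have e2 : deriv (modeDeriv Ω μ ψ v) = fun t => ((m : ℂ) ^ 2 + q t) * ψ t :=
    funext fun t => (hder2 t).deriv
  obtain ⟨C, hC⟩ := h.decay
  refine ⟨?_, memLp_two_of_norm_le_exp h.continuous hC, fun t ht => ?_⟩
  · rw [← one_add_one_eq_two, contDiff_succ_iff_deriv]
    refine ⟨fun t => (hder t).differentiableAt, by simp, ?_⟩
    rw [e1, contDiff_one_iff_deriv]
    refine ⟨fun t => (hder2 t).differentiableAt, ?_⟩
    rw [e2]
    exact (continuous_const.add (Complex.continuous_ofReal.comp hqc)).mul h.continuous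
  · have htd : t ≠ d := fun e => ht (by rw [e, hd])
    rw [e1, e2]
    simp only [hqe t htd]
    push_cast
    ring

end Mode

end RadialFlow

theorem proposition3p3 (α : ℝ) (hα0 : 0 < α) (hα2 : α < 2)
    (Ω : ℝ → ℝ) (Ωinf a b : ℝ) (hΩ : RadialFlow.IsClassC α Ω Ωinf a b)
    (m₀ μ₀ : ℝ) (hm₀ : 1 ≤ m₀) (hμ₀ : 0 < μ₀) (hμ₀' : μ₀ < Ωinf)
    (hlim : AccPt ((m₀, (μ₀ : ℂ)) : ℝ × ℂ) (𝓟 (RadialFlow.unstablePairs Ω))) :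
    (μ₀ = Ω a ∨ μ₀ = Ω b) ∧
      ∃ ψ₀ : ℝ → ℂ, ψ₀ ≠ 0 ∧ RadialFlow.IsL2Solution Ω m₀ (μ₀ : ℂ) ψ₀ ∧
        ∃ C δ : ℝ, 0 < δ ∧ ∀ t : ℝ, ‖ψ₀ t‖ ≤ C * Real.exp (-δ * |t|) := by
  obtain ⟨d, hd⟩ := hΩ.exists_eq hα0 hα2 hμ₀ hμ₀'
  obtain ⟨T, -, η, hη, htail⟩ := hΩ.exists_tail hα0 hα2 hμ₀ hμ₀'
  obtain ⟨ψ, v, h⟩ := hΩ.exists_isLimitMode hα0 hα2 hm₀ hμ₀ hμ₀' hd hlim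
  have htail₀ : ∀ t, T ≤ |t| → ‖(RadialFlow.coeffA Ω t : ℂ) / (Ω t - (μ₀ : ℂ))‖ ≤ 1 / 4 :=
    fun t ht => htail t ht μ₀ (by simpa using hη.le)
  -- Non-vanishing at `d` excludes the second alternative of the flux identity and also shows that
  -- the mode is non-trivial.
  have hψd : ψ d ≠ 0 := h.ne_zero_at hΩ hα0 hα2 hm₀ hμ₀ hd htail₀
  have hA : RadialFlow.coeffA Ω d = 0 := by
    have h1 := (h.slopeRatio_mul_eq_zero hΩ hd htail₀).resolve_right hψd
    exact (div_eq_zero_iff.1 h1).resolve_right (hΩ.deriv_neg d).ne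
  refine ⟨?_, ψ, fun e => hψd (congrFun e d), h.isL2Solution hΩ hd hA, ?_⟩
  · rcases (hΩ.zeroes d).1 hA with rfl | rfl
    · exact Or.inl hd.symm
    · exact Or.inr hd.symm
  · obtain ⟨C, hC⟩ := h.decay
    exact ⟨C, 1 / 2, by norm_num, hC⟩
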